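/- Conventions. Let $Z$ be a connected orbifold: a connected, second countable Hausdorff space with a countable atlas $\mathcal U$ of orbifold charts $(\widetilde U, G_U,\pi_U)$, where $\widetilde U\subset\mathbf R^m$ is a simply connected open set, $G_U$ is a finite group acting smoothly and effectively on $\widetilde U$, and $\pi_U$ induces a homeomorphism from $G_U\backslash\widetilde U$ onto an open set $U\subset Z$; two points of chart domains over the same point of $Z$ are exchanged by a coordinate transformation, i.e. a diffeomorphism between open subsets of the chart domains that commutes with the projections to $Z$. Let $\mathcal G$ be the groupoid with objects $\mathcal G_0=\coprod_{U}\widetilde U$ and with germs of coordinate transformations as arrows. A $\mathcal G$-path $c=(b_1,\dots,b_k;g_0,\dots,g_k)$, $k\ge 1$, from $x$ to $y$ consists of continuous paths $b_l$ in $\mathcal G_0$ and of arrows: $g_0$ from $x$ to the start of $b_1$, $g_l$ from the end of $b_l$ to the start of $b_{l+1}$, and $g_k$ from the end of $b_k$ to $y$. Homotopy of $\mathcal G$-paths is generated by subdivision (with identity arrows at new partition points), by replacing $(g_{l-1},b_l,g_l)$ by $(hg_{l-1},hb_l,g_lh^{-1})$ for a coordinate transformation $h$ defined near $b_l$, and by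 continuous deformations with $g_0$ and $g_k$ fixed. Fix $x_0\in\mathcal G_0$. The orbifold fundamental group $\Gamma$ is the group of homotopy classes of $\mathcal G$-loops at $x_0$, where $[c][c']$ is the class of $c$ followed by $c'$. Let $\widehat{\mathcal G}_0$ be the space of homotopy classes of $\mathcal G$-paths starting at $x_0$, with the topology for which the end point map to $\mathcal G_0$ is a covering, and let $X$ be its quotient by the relation $[c]\sim[c\,g]$ for arrows $g$ at the end point of $c$. The group $\Gamma$ acts on $X$ on the left by composition at $x_0$. A proper flat orbifold vector bundle of rank $r$ on $Z$ is a second countable Hausdorff space $\mathcal F$ with a continuous map $\mathcal F\to Z$ and with charts $\psi:\widetilde U\times\mathbf C^r\to\mathcal F|_U$, over charts $(\widetilde U,G_U,\pi_U)$ of the orbifold $Z$ that cover $Z$ (with $\widetilde U$ connected), such that for each of them there is a representation $G_U\to \mathrm{GL}_r(\mathbf C)$ for which $\psi$ induces a homeomorphism $G_U\backslash(\widetilde U\times\mathbf C^r)\simeq\mathcal F|_U$ over $U$, and such that near any two points over the same point of $Z$ two charts differ by a map $(x,v)\mapsto(f(x),Av)$ with a coordinate transformation $f$ and a constant matrix $A\in\mathrm{GL}_r(\mathbf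 C)$. An isomorphism of such bundles is a homeomorphism of the total spaces over $Z$ that has this same form in the charts (an isomorphism of flat bundles). Let $\mathcal M_r^{\mathrm{pr}}(Z)$ be the set of isomorphism classes, and let $\mathrm{Hom}(\Gamma,\mathrm{GL}_r(\mathbf C))/_\sim$ be the set of representations up to conjugation by $\mathrm{GL}_r(\mathbf C)$. Theorem. Let $r\ge 0$. (1) Every proper flat orbifold vector bundle $F$ of rank $r$ on $Z$ has flat trivializations $\widetilde U\times\mathbf C^r\to\mathcal F|_U$, of the kind above and compatible with its charts, over all charts of $\mathcal U$. For any choice of them, every arrow $g$ of $\mathcal G$ acts on the fibres by a matrix $g_*^F\in\mathrm{GL}_r(\mathbf C)$, and the parallel transport $\tau_c=g_{k,*}^F\cdots g_{0,*}^F$ along a $\mathcal G$-path $c=(b_1,\dots,b_k;g_0,\dots,g_k)$ is well defined. The rule $[c]\mapsto\tau_c^{-1}$, for $\mathcal G$-loops $c$ at $x_0$, is a well-defined homomorphism $\Gamma\to\mathrm{GL}_r(\mathbf C)$, the holonomy representation of $F$. (2) For every representation $\rho:\Gamma\to\mathrm{GL}_r(\mathbf C)$, the quotient $X\times_\rho\mathbf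 C^r$ of $X\times\mathbf C^r$ by the action $\gamma(x,v)=(\gamma x,\rho(\gamma)v)$, with its canonical charts (induced by the sheets of $\widehat{\mathcal G}_0\to\mathcal G_0$), is a proper flat orbifold vector bundle of rank $r$ on $Z$. (3) The map $\rho\mapsto X\times_\rho\mathbf C^r$ descends to a well-defined bijection $$\mathrm{Hom}(\Gamma,\mathrm{GL}_r(\mathbf C))/_\sim\;\longrightarrow\;\mathcal M_r^{\mathrm{pr}}(Z),$$ and its inverse sends the class of $F$ to the class of the holonomy representation of $F$, for every choice of flat trivializations. -/

import Mathlib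

open CategoryTheory
open scoped Manifold ContDiff Topology unitInterval

universe u

noncomputable section

namespace FlatOrb

/-! ### Orbifold charts and orbifold atlases -/

/-- An `m`-dimensional orbifold chart of the space `Z`: a connected open set `dom` of `ℝ^m`, a
finite group `G` acting smoothly and effectively on it, and a continuous `G`-invariant map
`proj : dom → Z` that induces a homeomorphism from `G \ dom` onto an open set `U` of `Z`.
Since the orbit map `dom → G \ dom` is open, the last condition says exactly that `proj` is
continuous and open and that its fibres are the orbits of `G`; `U` is the range of `proj`. -/
structure OrbChart (m : ℕ) (Z : Type u) [TopologicalSpace Z] where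
  dom : TopologicalSpace.Opens (EuclideanSpace ℝ (Fin m))
  connected : ConnectedSpace dom
  G : Type
  [group : Group G]
  [finite : Finite G]
  [action : MulAction G dom]
  [effective : FaithfulSMul G dom]
  smooth_smul : ∀ g : G, ContMDiff 𝓘(ℝ, EuclideanSpace ℝ (Fin m))
    𝓘(ℝ, EuclideanSpace ℝ (Fin m)) ∞ (fun x : dom => g • x)
  proj : dom → Z
  continuous_proj : Continuous proj
  isOpenMap_proj : IsOpenMap proj
  proj_eq_iff : ∀ x y : dom, proj x = proj y ↔ ∃ g : G, g • x = y

attribute [instance] OrbChart.group OrbChart.finite OrbChart.action OrbChart.effective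

variable {m : ℕ} {Z : Type u} [TopologicalSpace Z]

/-- A coordinate transformation between two orbifold charts: a diffeomorphism from an open subset
of `c.dom` onto an open subset of `d.dom` that commutes with the projections to `Z`. -/
structure Transition (c d : OrbChart m Z) where
  toHomeo : OpenPartialHomeomorph c.dom d.dom
  smooth : ContMDiffOn 𝓘(ℝ, EuclideanSpace ℝ (Fin m)) 𝓘(ℝ, EuclideanSpace ℝ (Fin m)) ∞
    toHomeo toHomeo.source
  smooth_symm : ContMDiffOn 𝓘(ℝ, EuclideanSpace ℝ (Fin m)) 𝓘(ℝ, EuclideanSpace ℝ (Fin m)) ∞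
    toHomeo.symm toHomeo.target
  proj_comp : ∀ x ∈ toHomeo.source, d.proj (toHomeo x) = c.proj x

namespace Transition

/-- The identity coordinate transformation. -/
def refl (c : OrbChart m Z) : Transition c c where
  toHomeo := OpenPartialHomeomorph.refl c.dom
  smooth := contMDiff_id.contMDiffOn
  smooth_symm := contMDiff_id.contMDiffOn
  proj_comp := fun _ _ => rfl

/-- The inverse coordinate transformation. -/
def symm {c d : OrbChart m Z} (f : Transition c d) : Transition d c where
  toHomeo := f.toHomeo.symm
  smooth := f.smooth_symm
  smooth_symm := f.smooth
  proj_comp := by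
    intro y hy
    have h := f.proj_comp (f.toHomeo.symm y) (f.toHomeo.map_target hy)
    rw [f.toHomeo.right_inv hy] at h
    exact h.symm

/-- Composition of coordinate transformations, on the largest possible domain. -/
def trans {c d e : OrbChart m Z} (f : Transition c d) (g : Transition d e) : Transition c e where
  toHomeo := f.toHomeo.trans g.toHomeo
  smooth := by
    refine g.smooth.comp (f.smooth.mono ?_) ?_
    · intro x hx
      exact (by simpa using hx : x ∈ f.toHomeo.source ∧ f.toHomeo x ∈ g.toHomeo.source).1
    · intro x hx
      exact (by simpa using hx : x ∈ f.toHomeo.source ∧ f.toHomeo x ∈ g.toHomeo.source).2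
  smooth_symm := by
    refine f.smooth_symm.comp (g.smooth_symm.mono ?_) ?_
    · intro x hx
      rw [OpenPartialHomeomorph.trans_target] at hx
      exact hx.1
    · intro x hx
      rw [OpenPartialHomeomorph.trans_target] at hx
      exact hx.2
  proj_comp := by
    intro x hx
    have h : x ∈ f.toHomeo.source ∧ f.toHomeo x ∈ g.toHomeo.source := by simpa using hx
    exact (g.proj_comp _ h.2).trans (f.proj_comp _ h.1)

end Transition

/-- Compatibility of orbifold charts: any two points lying over the same point of `Z` are
exchanged by a coordinate transformation. -/
def OrbChart.Compatible (c d : OrbChart m Z) : Prop :=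
  ∀ (x : c.dom) (y : d.dom), c.proj x = d.proj y →
    ∃ f : Transition c d, x ∈ f.toHomeo.source ∧ f.toHomeo x = y

variable (m Z) in
/-- A countable orbifold atlas by simply connected charts. It represents the orbifold structure
of `Z`. -/
structure OrbAtlas where
  ι : Type
  [countable : Countable ι]
  chart : ι → OrbChart m Z
  [simplyConnected : ∀ i, SimplyConnectedSpace (chart i).dom]
  cover : ∀ z : Z, ∃ (i : ι) (x : (chart i).dom), (chart i).proj x = z
  compatible : ∀ i j, (chart i).Compatible (chart j)

attribute [instance] OrbAtlas.countable OrbAtlas.simplyConnected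

namespace OrbAtlas

variable (𝒜 : OrbAtlas m Z)

/-! ### The groupoid of an orbifold atlas -/

/-- The objects of the groupoid: the disjoint union of the chart domains. -/
structure Obj where
  idx : 𝒜.ι
  pos : (𝒜.chart idx).dom

variable {𝒜}

/-- The point `x` of the `i`-th chart domain as an object of the groupoid. -/
abbrev pt (i : 𝒜.ι) (x : (𝒜.chart i).dom) : 𝒜.Obj := ⟨i, x⟩

/-- A coordinate transformation defined near `x` and sending `x` to `y`. -/
structure LocalArrow (x y : 𝒜.Obj) where
  map : Transition (𝒜.chart x.idx) (𝒜.chart y.idx)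
  mem : x.pos ∈ map.toHomeo.source
  map_eq : map.toHomeo x.pos = y.pos

/-- Two local coordinate transformations are identified if they have the same germ at `x`. -/
instance germSetoid (x y : 𝒜.Obj) : Setoid (LocalArrow x y) where
  r f g := ∀ᶠ w in 𝓝 x.pos, f.map.toHomeo w = g.map.toHomeo w
  iseqv := by
    refine ⟨fun f => Filter.Eventually.of_forall fun _ => rfl, fun h => ?_, fun h k => ?_⟩
    · exact h.mono fun _ hw => hw.symm
    · filter_upwards [h, k] with w h1 h2 using h1.trans h2

/-- Arrows of the groupoid: germs at `x` of coordinate transformations sending `x` to `y`. -/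
def Arrow (x y : 𝒜.Obj) : Type := Quotient (germSetoid x y)

namespace LocalArrow

def refl (x : 𝒜.Obj) : LocalArrow x x := ⟨Transition.refl _, trivial, rfl⟩

def comp {x y z : 𝒜.Obj} (f : LocalArrow x y) (g : LocalArrow y z) : LocalArrow x z where
  map := f.map.trans g.map
  mem := by
    change x.pos ∈ (f.map.toHomeo.trans g.map.toHomeo).source
    rw [OpenPartialHomeomorph.trans_source]
    refine ⟨f.mem, ?_⟩
    rw [Set.mem_preimage, f.map_eq]
    exact g.mem
  map_eq := by
    change g.map.toHomeo (f.map.toHomeo x.pos) = z.pos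
    rw [f.map_eq, g.map_eq]

def inv {x y : 𝒜.Obj} (f : LocalArrow x y) : LocalArrow y x where
  map := f.map.symm
  mem := by
    change y.pos ∈ f.map.toHomeo.target
    rw [← f.map_eq]
    exact f.map.toHomeo.map_source f.mem
  map_eq := by
    change f.map.toHomeo.symm y.pos = x.pos
    rw [← f.map_eq]
    exact f.map.toHomeo.left_inv f.mem

theorem tendsto {x y : 𝒜.Obj} (f : LocalArrow x y) :
    Filter.Tendsto f.map.toHomeo (𝓝 x.pos) (𝓝 y.pos) := by
  have h := f.map.toHomeo.continuousAt f.mem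
  unfold ContinuousAt at h
  rwa [f.map_eq] at h

end LocalArrow

/-- The groupoid of the atlas. Composition `f ≫ g` means first `f`, then `g`. -/
instance instGroupoidObj : Groupoid 𝒜.Obj where
  Hom x y := Arrow x y
  id x := ⟦LocalArrow.refl x⟧
  comp {x y z} f g := Quotient.map₂ LocalArrow.comp (by
    intro f f' hf g g' hg
    have h1 : ∀ᶠ w in 𝓝 x.pos, f.map.toHomeo w = f'.map.toHomeo w := hf
    have h2 : ∀ᶠ w in 𝓝 x.pos, g.map.toHomeo (f.map.toHomeo w) = g'.map.toHomeo (f.map.toHomeo w) :=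
      f.tendsto.eventually hg
    change ∀ᶠ w in 𝓝 x.pos, g.map.toHomeo (f.map.toHomeo w) = g'.map.toHomeo (f'.map.toHomeo w)
    filter_upwards [h1, h2] with w h1 h2
    rw [h2, h1]) f g
  inv {x y} f := Quotient.map LocalArrow.inv (by
    intro f f' hf
    have h1 : ∀ᶠ w in 𝓝 x.pos, f.map.toHomeo w = f'.map.toHomeo w := hf
    change ∀ᶠ w in 𝓝 y.pos, f.map.toHomeo.symm w = f'.map.toHomeo.symm w
    have h2 := f.inv.tendsto.eventually h1
    have h3 : ∀ᶠ w in 𝓝 y.pos, w ∈ f.map.toHomeo.target :=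
      f.map.toHomeo.open_target.mem_nhds f.inv.mem
    have h4 : ∀ᶠ w in 𝓝 y.pos, f.map.toHomeo.symm w ∈ f'.map.toHomeo.source :=
      f.inv.tendsto.eventually (f'.map.toHomeo.open_source.mem_nhds f'.mem)
    filter_upwards [h2, h3, h4] with w h2 h3 h4
    change f.map.toHomeo (f.map.toHomeo.symm w) = f'.map.toHomeo (f.map.toHomeo.symm w) at h2
    rw [f.map.toHomeo.right_inv h3] at h2
    rw [h2, f'.map.toHomeo.left_inv h4, ← h2]) f
  id_comp f := by
    induction f using Quotient.inductionOn
    exact Quotient.sound (Filter.Eventually.of_forall fun _ => rfl)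
  comp_id f := by
    induction f using Quotient.inductionOn
    exact Quotient.sound (Filter.Eventually.of_forall fun _ => rfl)
  assoc f g h := by
    induction f using Quotient.inductionOn
    induction g using Quotient.inductionOn
    induction h using Quotient.inductionOn
    exact Quotient.sound (Filter.Eventually.of_forall fun _ => rfl)
  inv_comp {x y} f := by
    induction f using Quotient.inductionOn with
    | h f =>
      refine Quotient.sound ?_
      have h3 : ∀ᶠ w in 𝓝 y.pos, w ∈ f.map.toHomeo.target :=
        f.map.toHomeo.open_target.mem_nhds f.inv.mem
      exact h3.mono fun w hw => f.map.toHomeo.right_inv hw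
  comp_inv {x y} f := by
    induction f using Quotient.inductionOn with
    | h f =>
      refine Quotient.sound ?_
      have h3 : ∀ᶠ w in 𝓝 x.pos, w ∈ f.map.toHomeo.source :=
        f.map.toHomeo.open_source.mem_nhds f.mem
      exact h3.mono fun w hw => f.map.toHomeo.left_inv hw

/-- The arrow given by the germ at `x` of a coordinate transformation `f` defined near `x`. -/
def germ {i j : 𝒜.ι} (f : Transition (𝒜.chart i) (𝒜.chart j)) (x : (𝒜.chart i).dom)
    (hx : x ∈ f.toHomeo.source) : pt i x ⟶ pt j (f.toHomeo x) :=
  Quotient.mk (germSetoid (pt i x) (pt j (f.toHomeo x))) ⟨f, hx, rfl⟩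

variable (𝒜) in
/-- The space of all arrows. -/
structure ArrowSpace where
  source : 𝒜.Obj
  target : 𝒜.Obj
  arrow : source ⟶ target

/-- The germ topology: a set of arrows is open if, for every coordinate transformation `f`, the
points at which the germ of `f` belongs to the set form an open set. -/
instance : TopologicalSpace (ArrowSpace 𝒜) :=
  ⨆ (i : 𝒜.ι) (j : 𝒜.ι) (f : Transition (𝒜.chart i) (𝒜.chart j)),
    TopologicalSpace.coinduced
      (fun x : f.toHomeo.source => (⟨pt i x.1, pt j (f.toHomeo x.1), germ f x.1 x.2⟩ :
        ArrowSpace 𝒜)) inferInstance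

/-! ### Paths in the groupoid and their homotopy classes -/

/-- A `𝒢`-path `(b₁, …, b_k; g₀, …, g_k)`, `k ≥ 1`, from `x` to `y`. A continuous path into the
disjoint union of the chart domains stays in one of them, so each `b_l` is a path in some chart
domain. Each `b_l` is reparametrized by the unit interval; this is harmless as homotopies may move
the partition points. -/
inductive GPath : 𝒜.Obj → 𝒜.Obj → Type
  | single {x y : 𝒜.Obj} {i : 𝒜.ι} {a b : (𝒜.chart i).dom}
      (g₀ : x ⟶ pt i a) (p : Path a b) (g₁ : pt i b ⟶ y) : GPath x y
  | cons {x y : 𝒜.Obj} {i : 𝒜.ι} {a b : (𝒜.chart i).dom}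
      (g₀ : x ⟶ pt i a) (p : Path a b) (c : GPath (pt i b) y) : GPath x y

namespace GPath

/-- Compose the first arrow of a `𝒢`-path with an arrow. -/
def pre {w x y : 𝒜.Obj} (h : w ⟶ x) : GPath x y → GPath w y
  | single g₀ p g₁ => single (h ≫ g₀) p g₁
  | cons g₀ p c => cons (h ≫ g₀) p c

/-- Composition of `𝒢`-paths: first `c`, then `d`. -/
def trans {x y z : 𝒜.Obj} : GPath x y → GPath y z → GPath x z
  | single g₀ p g₁, d => cons g₀ p (d.pre g₁)
  | cons g₀ p c, d => cons g₀ p (c.trans d)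

/-- The constant `𝒢`-path at `x` followed by the arrow `g`. -/
def ofArrow {x y : 𝒜.Obj} (g : x ⟶ y) : GPath x y :=
  single (i := x.idx) (𝟙 x) (Path.refl x.pos) g

/-- The constant loop. -/
def refl (x : 𝒜.Obj) : GPath x x := ofArrow (𝟙 x)

/-- The `𝒢`-path given by an ordinary path in a chart domain. -/
def ofPath {i : 𝒜.ι} {a b : (𝒜.chart i).dom} (p : Path a b) : GPath (pt i a) (pt i b) :=
  single (𝟙 _) p (𝟙 _)

/-- The inverse `𝒢`-path. -/
def symm {x y : 𝒜.Obj} : GPath x y → GPath y x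
  | single g₀ p g₁ => single (Groupoid.inv g₁) p.symm (Groupoid.inv g₀)
  | cons g₀ p c => c.symm.trans (single (𝟙 _) p.symm (Groupoid.inv g₀))

end GPath

/-- A family, parametrized by `s ∈ [0,1]`, of `𝒢`-paths with the first arrow removed: all paths
and all intermediate arrows depend continuously on `s`, and the last arrow does not depend
on `s`. The first path starts at `a s`. -/
inductive PathFamily : {i : 𝒜.ι} → (I → (𝒜.chart i).dom) → 𝒜.Obj → Type
  | last {i : 𝒜.ι} {a : I → (𝒜.chart i).dom} {y : 𝒜.Obj} {b : (𝒜.chart i).dom}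
      (p : ∀ s, Path (a s) b) (hp : Continuous fun q : I × I => p q.1 q.2)
      (g : pt i b ⟶ y) : PathFamily a y
  | step {i j : 𝒜.ι} {a b : I → (𝒜.chart i).dom} {y : 𝒜.Obj} {a' : I → (𝒜.chart j).dom}
      (p : ∀ s, Path (a s) (b s)) (hp : Continuous fun q : I × I => p q.1 q.2)
      (g : ∀ s, pt i (b s) ⟶ pt j (a' s))
      (hg : Continuous fun s => (⟨pt i (b s), pt j (a' s), g s⟩ : ArrowSpace 𝒜))
      (F : PathFamily a' y) : PathFamily a y

/-- The member of a family at the parameter `s`, with the first arrow `g₀` put back. -/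
def PathFamily.eval {i : 𝒜.ι} {a : I → (𝒜.chart i).dom} {x y : 𝒜.Obj} :
    PathFamily a y → (s : I) → (x ⟶ pt i (a s)) → GPath x y
  | .last p _ g, s, g₀ => .single g₀ (p s) g
  | .step p _ g _ F, s, g₀ => .cons g₀ (p s) (F.eval s (g s))

/-- The elementary moves that generate homotopy of `𝒢`-paths: subdivision of a path with an
identity arrow at the new partition point, translation of a path by a coordinate transformation
`h` defined near it, and elementary homotopies, in which the first and the last arrow do not
depend on the parameter. -/
inductive GPath.Step : {x y : 𝒜.Obj} → GPath x y → GPath x y → Prop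
  | subdivide_single {x y : 𝒜.Obj} {i : 𝒜.ι} {a b c : (𝒜.chart i).dom}
      (g₀ : x ⟶ pt i a) (p : Path a b) (q : Path b c) (g₁ : pt i c ⟶ y) :
      Step (.single g₀ (p.trans q) g₁) (.cons g₀ p (.single (𝟙 _) q g₁))
  | subdivide_cons {x y : 𝒜.Obj} {i : 𝒜.ι} {a b c : (𝒜.chart i).dom}
      (g₀ : x ⟶ pt i a) (p : Path a b) (q : Path b c) (d : GPath (pt i c) y) :
      Step (.cons g₀ (p.trans q) d) (.cons g₀ p (.cons (𝟙 _) q d))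
  | translate_single {x y : 𝒜.Obj} {i j : 𝒜.ι} {a b : (𝒜.chart i).dom}
      (g₀ : x ⟶ pt i a) (p : Path a b) (g₁ : pt i b ⟶ y)
      (h : Transition (𝒜.chart i) (𝒜.chart j)) (hs : ∀ t, p t ∈ h.toHomeo.source)
      (ha : a ∈ h.toHomeo.source) (hb : b ∈ h.toHomeo.source)
      (hc : ContinuousOn h.toHomeo (Set.range p)) :
      Step (.single g₀ p g₁)
        (.single (g₀ ≫ germ h a ha) (p.map' hc) (Groupoid.inv (germ h b hb) ≫ g₁))
  | translate_cons {x y : 𝒜.Obj} {i j : 𝒜.ι} {a b : (𝒜.chart i).dom}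
      (g₀ : x ⟶ pt i a) (p : Path a b) (d : GPath (pt i b) y)
      (h : Transition (𝒜.chart i) (𝒜.chart j)) (hs : ∀ t, p t ∈ h.toHomeo.source)
      (ha : a ∈ h.toHomeo.source) (hb : b ∈ h.toHomeo.source)
      (hc : ContinuousOn h.toHomeo (Set.range p)) :
      Step (.cons g₀ p d)
        (.cons (g₀ ≫ germ h a ha) (p.map' hc) (d.pre (Groupoid.inv (germ h b hb))))
  | congr_cons {x y : 𝒜.Obj} {i : 𝒜.ι} {a b : (𝒜.chart i).dom}
      (g₀ : x ⟶ pt i a) (p : Path a b) {c c' : GPath (pt i b) y} (h : Step c c') :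
      Step (.cons g₀ p c) (.cons g₀ p c')
  | homotopy {x y : 𝒜.Obj} {i : 𝒜.ι} {a : (𝒜.chart i).dom} (g₀ : x ⟶ pt i a)
      (F : PathFamily (fun _ => a) y) : Step (F.eval 0 g₀) (F.eval 1 g₀)

/-- Homotopy classes of `𝒢`-paths from `x` to `y`: the quotient by the equivalence relation
generated by the elementary moves. -/
def PathClass (x y : 𝒜.Obj) : Type := Quot (GPath.Step (x := x) (y := y))

namespace GPath

theorem pre_id {x y : 𝒜.Obj} (c : GPath x y) : c.pre (𝟙 x) = c := by
  cases c <;> simp [pre]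

theorem pre_pre {v w x y : 𝒜.Obj} (h : v ⟶ w) (k : w ⟶ x) (c : GPath x y) :
    (c.pre k).pre h = c.pre (h ≫ k) := by
  cases c <;> simp [pre]

theorem pre_trans {w x y z : 𝒜.Obj} (h : w ⟶ x) (c : GPath x y) (d : GPath y z) :
    (c.trans d).pre h = (c.pre h).trans d := by
  cases c <;> simp [pre, trans]

theorem trans_assoc {w x y z : 𝒜.Obj} (c : GPath w x) (d : GPath x y) (e : GPath y z) :
    (c.trans d).trans e = c.trans (d.trans e) := by
  induction c with
  | single g₀ p g₁ => simp [trans, pre_trans]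
  | cons g₀ p c ih => simp [trans, ih]

theorem eval_pre {w x y : 𝒜.Obj} {i : 𝒜.ι} {a : I → (𝒜.chart i).dom} (F : PathFamily a y)
    (s : I) (h : w ⟶ x) (g₀ : x ⟶ pt i (a s)) : (F.eval s g₀).pre h = F.eval s (h ≫ g₀) := by
  cases F <;> rfl

theorem step_pre {w x y : 𝒜.Obj} (h : w ⟶ x) {c c' : GPath x y} (hc : Step c c') :
    Step (c.pre h) (c'.pre h) := by
  cases hc with
  | subdivide_single g₀ p q g₁ => exact .subdivide_single _ _ _ _
  | subdivide_cons g₀ p q d => exact .subdivide_cons _ _ _ _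
  | translate_single g₀ p g₁ k hs ha hb hc =>
    have := Step.translate_single (h ≫ g₀) p g₁ k hs ha hb hc
    rw [Category.assoc] at this
    exact this
  | translate_cons g₀ p d k hs ha hb hc =>
    have := Step.translate_cons (h ≫ g₀) p d k hs ha hb hc
    rw [Category.assoc] at this
    exact this
  | congr_cons g₀ p hc => exact .congr_cons _ _ hc
  | homotopy g₀ F =>
    rw [eval_pre, eval_pre]
    exact .homotopy _ F

/-- A `𝒢`-path with the first arrow removed, as a constant family. -/
theorem exists_const {x y : 𝒜.Obj} (c : GPath x y) :
    ∃ (i : 𝒜.ι) (a : (𝒜.chart i).dom) (g₀ : x ⟶ pt i a) (F : PathFamily (fun _ => a) y),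
      ∀ (s : I) (w : 𝒜.Obj) (h : w ⟶ x), F.eval s (h ≫ g₀) = c.pre h := by
  induction c with
  | single g₀ p g₁ =>
    refine ⟨_, _, g₀, .last (fun _ => p) (p.continuous.comp continuous_snd) g₁, fun s w h => rfl⟩
  | cons g₀ p c ih =>
    obtain ⟨j, a', g, F, hF⟩ := ih
    refine ⟨_, _, g₀, .step (fun _ => p) (p.continuous.comp continuous_snd) (fun _ => g) continuous_const F,
      fun s w h => ?_⟩
    have := hF s _ (𝟙 _)
    rw [Category.id_comp, pre_id] at this
    simp [PathFamily.eval, pre, this]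

theorem exists_family_trans {y z : 𝒜.Obj} (d : GPath y z) {i : 𝒜.ι} {a : I → (𝒜.chart i).dom}
    (F : PathFamily a y) :
    ∃ F' : PathFamily a z, ∀ (s : I) (x : 𝒜.Obj) (g₀ : x ⟶ pt i (a s)),
      F'.eval s g₀ = (F.eval s g₀).trans d := by
  induction F with
  | last p hp g =>
    obtain ⟨j, a', k, F, hF⟩ := d.exists_const
    refine ⟨.step p hp (fun _ => g ≫ k) continuous_const F, fun s x g₀ => ?_⟩
    simp [PathFamily.eval, trans, hF]
  | step p hp g hg F ih =>
    obtain ⟨F', hF'⟩ := ih d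
    exact ⟨.step p hp g hg F', fun s x g₀ => by simp [PathFamily.eval, trans, hF']⟩

theorem step_trans_right {x y z : 𝒜.Obj} {c c' : GPath x y} (h : Step c c') (d : GPath y z) :
    Step (c.trans d) (c'.trans d) := by
  induction h with
  | subdivide_single g₀ p q g₁ => exact .subdivide_cons _ _ _ _
  | subdivide_cons g₀ p q e => exact .subdivide_cons _ _ _ _
  | translate_single g₀ p g₁ k hs ha hb hc =>
    have := Step.translate_cons g₀ p (d.pre g₁) k hs ha hb hc
    rw [pre_pre] at this
    exact this
  | translate_cons g₀ p e k hs ha hb hc =>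
    have := Step.translate_cons g₀ p (e.trans d) k hs ha hb hc
    rw [pre_trans] at this
    exact this
  | congr_cons g₀ p h ih => exact .congr_cons _ _ (ih d)
  | homotopy g₀ F =>
    obtain ⟨F', hF'⟩ := exists_family_trans d F
    rw [← hF', ← hF']
    exact .homotopy _ F'

theorem step_trans_left {x y z : 𝒜.Obj} (c : GPath x y) {d d' : GPath y z} (h : Step d d') :
    Step (c.trans d) (c.trans d') := by
  induction c with
  | single g₀ p g₁ => exact .congr_cons _ _ (step_pre _ h)
  | cons g₀ p c ih => exact .congr_cons _ _ (ih h)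

/-- The homotopy class of a `𝒢`-path. -/
def cls {x y : 𝒜.Obj} (c : GPath x y) : PathClass x y := Quot.mk _ c

end GPath

namespace PathClass

/-- Composition of homotopy classes: first `c`, then `d`. -/
def comp {x y z : 𝒜.Obj} (c : PathClass x y) (d : PathClass y z) : PathClass x z :=
  Quot.map₂ GPath.trans (fun c _ _ h => c.step_trans_left h)
    (fun _ _ d h => GPath.step_trans_right h d) c d

theorem comp_assoc {w x y z : 𝒜.Obj} (c : PathClass w x) (d : PathClass x y)
    (e : PathClass y z) : (c.comp d).comp e = c.comp (d.comp e) := by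
  induction c using Quot.inductionOn
  induction d using Quot.inductionOn
  induction e using Quot.inductionOn
  exact congrArg (Quot.mk _) (GPath.trans_assoc _ _ _)

theorem single_homotopic {x y : 𝒜.Obj} {i : 𝒜.ι} {a b : (𝒜.chart i).dom} (g₀ : x ⟶ pt i a)
    {p q : Path a b} (h : p.Homotopic q) (g₁ : pt i b ⟶ y) :
    (GPath.single g₀ p g₁).cls = (GPath.single g₀ q g₁).cls := by
  obtain ⟨H⟩ := h
  have := GPath.Step.homotopy g₀ (.last (a := fun _ => a) (fun s => H.eval s)
    (by exact H.continuous) g₁)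
  have h2 := Quot.sound this
  simp only [PathFamily.eval, Path.Homotopy.eval_zero, Path.Homotopy.eval_one] at h2
  exact h2

theorem cons_homotopic {x y : 𝒜.Obj} {i : 𝒜.ι} {a b : (𝒜.chart i).dom} (g₀ : x ⟶ pt i a)
    {p q : Path a b} (h : p.Homotopic q) (d : GPath (pt i b) y) :
    (GPath.cons g₀ p d).cls = (GPath.cons g₀ q d).cls := by
  have h1 := single_homotopic g₀ h (𝟙 _)
  have h2 := congrArg (fun c => comp c d.cls) h1
  simpa [comp, GPath.cls, GPath.trans, GPath.pre_id, Quot.map₂_mk] using h2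

theorem single_const {x y z : 𝒜.Obj} (g₀ : x ⟶ y) (g₁ : y ⟶ z) :
    (GPath.single (i := y.idx) g₀ (Path.refl y.pos) g₁).cls = GPath.cls (.ofArrow (g₀ ≫ g₁)) := by
  induction g₀ using Quotient.inductionOn with
  | h f =>
    obtain ⟨i, a⟩ := x
    obtain ⟨j, b⟩ := y
    have key : ∀ (f : Transition (𝒜.chart i) (𝒜.chart j)) (hf : a ∈ f.toHomeo.source)
        (b : (𝒜.chart j).dom) (he : f.toHomeo a = b) (g₁ : pt j b ⟶ z),
        (GPath.single (i := j) (Quotient.mk (germSetoid (pt i a) (pt j b)) ⟨f, hf, he⟩ :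
          pt i a ⟶ pt j b) (Path.refl b) g₁).cls
        = GPath.cls (.ofArrow ((Quotient.mk (germSetoid (pt i a) (pt j b)) ⟨f, hf, he⟩ :
          pt i a ⟶ pt j b) ≫ g₁)) := by
      rintro f hf _ rfl g₁
      have hr : ∀ t : I, Path.refl a t ∈ f.toHomeo.source := fun t => hf
      have := GPath.Step.translate_single (𝟙 (pt i a)) (Path.refl a) (germ f a hf ≫ g₁) f
        hr hf hf (f.toHomeo.continuousOn.mono (by rintro _ ⟨t, rfl⟩; exact hr t))
      rw [Category.id_comp, ← Category.assoc, Groupoid.inv_comp, Category.id_comp] at this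
      exact (Quot.sound this).symm
    exact key f.map f.mem b f.map_eq g₁

theorem id_comp {x y : 𝒜.Obj} (c : PathClass x y) : (GPath.refl x).cls.comp c = c := by
  induction c using Quot.inductionOn with
  | h c =>
    change (GPath.cons (i := x.idx) (𝟙 x) (Path.refl x.pos) (c.pre (𝟙 x))).cls = c.cls
    rw [GPath.pre_id]
    have key : ∀ {i : 𝒜.ι} {a : (𝒜.chart i).dom} (g₀ : x ⟶ pt i a) (d : GPath (pt i a) y),
        (GPath.cons (i := x.idx) (𝟙 x) (Path.refl x.pos) (d.pre g₀)).cls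
          = (GPath.cons g₀ (Path.refl a) d).cls := by
      intro i a g₀ d
      have h := congrArg (fun c => comp c d.cls) (single_const g₀ (𝟙 _))
      simpa [comp, GPath.cls, GPath.trans, GPath.pre_id, Quot.map₂_mk, GPath.ofArrow]
        using h.symm
    cases c with
    | single g₀ p g₁ =>
      have h := key g₀ (.single (𝟙 _) p g₁)
      simp only [GPath.pre, Category.comp_id] at h
      rw [h]
      have h2 := Quot.sound (GPath.Step.subdivide_single g₀ (Path.refl _) p g₁)
      exact h2.symm.trans (single_homotopic g₀ ⟨Path.Homotopy.reflTrans p⟩ g₁)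
    | cons g₀ p d =>
      have h := key g₀ (.cons (𝟙 _) p d)
      simp only [GPath.pre, Category.comp_id] at h
      rw [h]
      have h2 := Quot.sound (GPath.Step.subdivide_cons g₀ (Path.refl _) p d)
      exact h2.symm.trans (cons_homotopic g₀ ⟨Path.Homotopy.reflTrans p⟩ d)

theorem single_comp_single {x y z : 𝒜.Obj} {i : 𝒜.ι} {a b c : (𝒜.chart i).dom}
    (g₀ : x ⟶ pt i a) (p : Path a b) (g₁ : pt i b ⟶ y) (h : y ⟶ pt i b) (q : Path b c)
    (g₂ : pt i c ⟶ z) (hg : g₁ ≫ h = 𝟙 _) :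
    (GPath.single g₀ p g₁).cls.comp (GPath.single h q g₂).cls
      = (GPath.single g₀ (p.trans q) g₂).cls := by
  change (GPath.cons g₀ p (GPath.single (g₁ ≫ h) q g₂)).cls = _
  rw [hg]
  exact (Quot.sound (GPath.Step.subdivide_single g₀ p q g₂)).symm

theorem single_comp_symm {x y : 𝒜.Obj} {i : 𝒜.ι} {a b : (𝒜.chart i).dom}
    (g₀ : x ⟶ pt i a) (p : Path a b) (g₁ : pt i b ⟶ y) :
    (GPath.single g₀ p g₁).cls.comp
      (GPath.single (Groupoid.inv g₁) p.symm (Groupoid.inv g₀)).cls = (GPath.refl x).cls := by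
  rw [single_comp_single _ _ _ _ _ _ (Groupoid.comp_inv g₁),
    single_homotopic g₀ (Nonempty.intro (Path.Homotopy.reflTransSymm p).symm)]
  have h := single_const g₀ (Groupoid.inv g₀)
  rw [Groupoid.comp_inv] at h
  exact h

theorem symm_comp_single {x y : 𝒜.Obj} {i : 𝒜.ι} {a b : (𝒜.chart i).dom}
    (g₀ : x ⟶ pt i a) (p : Path a b) (g₁ : pt i b ⟶ y) :
    (GPath.single (Groupoid.inv g₁) p.symm (Groupoid.inv g₀)).cls.comp
      (GPath.single g₀ p g₁).cls = (GPath.refl y).cls := by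
  have h := single_comp_symm (Groupoid.inv g₁) p.symm (Groupoid.inv g₀)
  simpa using h

theorem cons_eq {x y : 𝒜.Obj} {i : 𝒜.ι} {a b : (𝒜.chart i).dom} (g₀ : x ⟶ pt i a)
    (p : Path a b) (c : GPath (pt i b) y) :
    (GPath.cons g₀ p c).cls = (GPath.single g₀ p (𝟙 _)).cls.comp c.cls := by
  change _ = (GPath.cons g₀ p (c.pre (𝟙 _))).cls
  rw [GPath.pre_id]

theorem comp_symm {x y : 𝒜.Obj} (c : GPath x y) :
    c.cls.comp c.symm.cls = (GPath.refl x).cls := by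
  induction c with
  | single g₀ p g₁ => exact single_comp_symm g₀ p g₁
  | cons g₀ p c ih =>
    have h := single_comp_symm g₀ p (𝟙 _)
    rw [show Groupoid.inv (𝟙 (pt _ _) : pt _ _ ⟶ _) = 𝟙 _ by simp] at h
    rw [cons_eq]
    change (comp _ c.cls).comp (c.symm.cls.comp (GPath.single (𝟙 _) p.symm _).cls) = _
    rw [comp_assoc, ← comp_assoc c.cls, ih, id_comp, h]

theorem symm_comp {x y : 𝒜.Obj} (c : GPath x y) :
    c.symm.cls.comp c.cls = (GPath.refl y).cls := by
  induction c with
  | single g₀ p g₁ => exact symm_comp_single g₀ p g₁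
  | cons g₀ p c ih =>
    have h := symm_comp_single g₀ p (𝟙 _)
    rw [show Groupoid.inv (𝟙 (pt _ _) : pt _ _ ⟶ _) = 𝟙 _ by simp] at h
    rw [cons_eq]
    change (c.symm.cls.comp (GPath.single (𝟙 _) p.symm _).cls).comp (comp _ c.cls) = _
    rw [comp_assoc, ← comp_assoc (GPath.single (𝟙 _) p.symm _).cls, h, id_comp, ih]

theorem comp_id {x y : 𝒜.Obj} (c : PathClass x y) : c.comp (GPath.refl y).cls = c := by
  induction c using Quot.inductionOn with
  | h c =>
    change c.cls.comp _ = c.cls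
    rw [← symm_comp c, ← comp_assoc, comp_symm, id_comp]

/-- The inverse of a homotopy class. -/
def inv {x y : 𝒜.Obj} (c : PathClass x y) : PathClass y x :=
  Quot.lift (fun c : GPath x y => c.symm.cls) (by
    intro c c' h
    have hc : c.cls = c'.cls := Quot.sound h
    change c.symm.cls = c'.symm.cls
    rw [← comp_id c.symm.cls, ← comp_symm c', ← hc, ← comp_assoc, symm_comp, id_comp]) c

theorem inv_comp {x y : 𝒜.Obj} (c : PathClass x y) : c.inv.comp c = (GPath.refl y).cls := by
  induction c using Quot.inductionOn with
  | h c => exact symm_comp c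

end PathClass

/-- The orbifold fundamental group: homotopy classes of `𝒢`-loops based at `x₀`. -/
def Pi1 (x₀ : 𝒜.Obj) : Type := PathClass x₀ x₀

/-- The product `[c][c']` is the class of `c` followed by `c'`. -/
instance (x₀ : 𝒜.Obj) : Group (Pi1 x₀) where
  mul c d := PathClass.comp c d
  one := (GPath.refl x₀).cls
  inv c := PathClass.inv c
  mul_assoc c d e := PathClass.comp_assoc c d e
  one_mul c := PathClass.id_comp c
  mul_one c := PathClass.comp_id c
  inv_mul_cancel c := PathClass.inv_comp c

/-! ### The universal covering orbifold -/

/-- The space of homotopy classes of `𝒢`-paths starting at `x₀`. -/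
structure PathSpace (x₀ : 𝒜.Obj) where
  target : 𝒜.Obj
  pathClass : PathClass x₀ target

/-- The sheet through the class `c`, which ends at the point `a` of a chart domain: to a point `b`
of the chart domain it assigns `c` followed by a path in the chart domain from `a` to `b`. As
the chart domain is simply connected, the choice of the path is irrelevant. -/
def sheet {x₀ : 𝒜.Obj} {i : 𝒜.ι} {a : (𝒜.chart i).dom} (c : PathClass x₀ (pt i a))
    (b : (𝒜.chart i).dom) : PathSpace x₀ :=
  ⟨pt i b, c.comp (GPath.ofPath (PathConnectedSpace.somePath a b)).cls⟩

/-- The sheets carry the topology of the chart domains and `PathSpace x₀` is their disjoint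
union. -/
instance (x₀ : 𝒜.Obj) : TopologicalSpace (PathSpace x₀) :=
  ⨆ (i : 𝒜.ι) (a : (𝒜.chart i).dom) (c : PathClass x₀ (pt i a)),
    TopologicalSpace.coinduced (sheet c) inferInstance

/-- The relation of being joined by an arrow: `[c]` is related to `[c]` followed by an arrow. -/
def PathSpace.Rel (x₀ : 𝒜.Obj) (c d : PathSpace x₀) : Prop :=
  ∃ g : c.target ⟶ d.target, d.pathClass = c.pathClass.comp (GPath.ofArrow g).cls

/-- The universal covering orbifold `X`: the orbit space of `PathSpace x₀` under the arrows. -/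
def UnivCover (x₀ : 𝒜.Obj) : Type := Quot (PathSpace.Rel x₀)

instance (x₀ : 𝒜.Obj) : TopologicalSpace (UnivCover x₀) :=
  inferInstanceAs (TopologicalSpace (Quot _))

/-- The action of the fundamental group on `X` by composition at the starting point. -/
instance (x₀ : 𝒜.Obj) : MulAction (Pi1 x₀) (UnivCover x₀) where
  smul γ := Quot.map (fun c => ⟨c.target, PathClass.comp γ c.pathClass⟩) (by
    rintro c d ⟨g, hg⟩
    exact ⟨g, (congrArg (PathClass.comp γ) hg).trans (PathClass.comp_assoc γ _ _).symm⟩)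
  one_smul x := by
    induction x using Quot.inductionOn with
    | h c =>
      obtain ⟨y, c⟩ := c
      exact congrArg (fun c => Quot.mk (PathSpace.Rel x₀) ⟨y, c⟩) (PathClass.id_comp c)
  mul_smul γ δ x := by
    induction x using Quot.inductionOn with
    | h c =>
      obtain ⟨y, c⟩ := c
      exact congrArg (fun c => Quot.mk (PathSpace.Rel x₀) ⟨y, c⟩) (PathClass.comp_assoc γ δ c)

/-- The projection `X → Z`. -/
def UnivCover.proj {x₀ : 𝒜.Obj} : UnivCover x₀ → Z :=
  Quot.lift (fun c : PathSpace x₀ => (𝒜.chart c.target.idx).proj c.target.pos) (by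
    rintro c d ⟨g, -⟩
    induction g using Quotient.inductionOn with
    | h f => rw [← f.map.proj_comp _ f.mem, f.map_eq])

theorem UnivCover.proj_smul {x₀ : 𝒜.Obj} (γ : Pi1 x₀) (x : UnivCover x₀) :
    (γ • x).proj = x.proj := by
  induction x using Quot.inductionOn
  rfl

end OrbAtlas

/-! ### Proper flat orbifold vector bundles -/

/-- The data of a total space over `Z` with a family of local trivializations: each is a map
`U' × ℂ^r → total`, where `U'` is the domain of an orbifold chart of `Z`. -/
structure BundleData (m : ℕ) (Z : Type u) [TopologicalSpace Z] (r : ℕ) where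
  total : Type
  [top : TopologicalSpace total]
  proj : total → Z
  charts : Set (Σ c : OrbChart m Z, c.dom × (Fin r → ℂ) → total)

attribute [instance] BundleData.top

/-- `ψ : c.dom × ℂ^r → T` is a proper linear orbifold chart over the chart `c` of `Z`: for some
representation `σ` of the group `c.G` on `ℂ^r` it is invariant under the diagonal action and it
induces a homeomorphism from the quotient of `c.dom × ℂ^r` by `c.G` onto the part of `T` over
the range of `c.proj`. -/
structure IsBundleChart {r : ℕ} {T : Type} [TopologicalSpace T] (π : T → Z) (c : OrbChart m Z)
    (ψ : c.dom × (Fin r → ℂ) → T) : Prop where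
  continuous : Continuous ψ
  isOpenMap : IsOpenMap ψ
  proj_eq : ∀ p, π (ψ p) = c.proj p.1
  range_eq : ∀ e : T, π e ∈ Set.range c.proj → e ∈ Set.range ψ
  exists_rep : ∃ R : c.G →* GL (Fin r) ℂ, ∀ p q : c.dom × (Fin r → ℂ),
    ψ p = ψ q ↔ ∃ g : c.G, (g • p.1, (R g).1.mulVec p.2) = q

/-- Two local trivializations with values in the same space are flatly compatible: near points
over the same point of `Z` they differ by `(x, v) ↦ (f x, A v)`, where `f` is a coordinate
transformation and `A` is a constant matrix. -/
def FlatCompatible {r : ℕ} {T : Type} (c : OrbChart m Z) (ψ : c.dom × (Fin r → ℂ) → T)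
    (d : OrbChart m Z) (χ : d.dom × (Fin r → ℂ) → T) : Prop :=
  ∀ (x : c.dom) (y : d.dom), c.proj x = d.proj y →
    ∃ (f : Transition c d) (A : GL (Fin r) ℂ), x ∈ f.toHomeo.source ∧ f.toHomeo x = y ∧
      ∀ w ∈ f.toHomeo.source, ∀ v : Fin r → ℂ, χ (f.toHomeo w, A.1.mulVec v) = ψ (w, v)

/-- The data form a proper flat orbifold vector bundle on `Z` with the orbifold structure
of `𝒜`. -/
structure IsProperFlat (𝒜 : OrbAtlas m Z) {r : ℕ} (D : BundleData m Z r) : Prop where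
  hausdorff : T2Space D.total
  secondCountable : SecondCountableTopology D.total
  continuous_proj : Continuous D.proj
  cover : ∀ z : Z, ∃ p ∈ D.charts, z ∈ Set.range p.1.proj
  compatible : ∀ p ∈ D.charts, ∀ i, p.1.Compatible (𝒜.chart i)
  isBundleChart : ∀ p ∈ D.charts, IsBundleChart D.proj p.1 p.2
  flat : ∀ p ∈ D.charts, ∀ q ∈ D.charts, FlatCompatible p.1 p.2 q.1 q.2

/-- Proper flat orbifold vector bundles of rank `r` on the orbifold. -/
def FlatBundle (𝒜 : OrbAtlas m Z) (r : ℕ) := {D : BundleData m Z r // IsProperFlat 𝒜 D}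

/-- Isomorphism of flat orbifold vector bundles: a homeomorphism of the total spaces over `Z` that
is given in the flat local trivializations by constant invertible matrices. -/
def FlatBundle.Iso {𝒜 : OrbAtlas m Z} {r : ℕ} (D E : FlatBundle 𝒜 r) : Prop :=
  ∃ Φ : D.1.total ≃ₜ E.1.total, (∀ e, E.1.proj (Φ e) = D.1.proj e) ∧
    ∀ p ∈ D.1.charts, ∀ q ∈ E.1.charts, FlatCompatible p.1 (Φ ∘ p.2) q.1 q.2

theorem FlatCompatible.symm {r : ℕ} {T : Type} {c : OrbChart m Z}
    {ψ : c.dom × (Fin r → ℂ) → T} {d : OrbChart m Z} {χ : d.dom × (Fin r → ℂ) → T}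
    (h : FlatCompatible c ψ d χ) : FlatCompatible d χ c ψ := by
  intro y x hxy
  obtain ⟨f, A, hx, rfl, hf⟩ := h x y hxy.symm
  refine ⟨f.symm, A⁻¹, f.toHomeo.map_source hx, f.toHomeo.left_inv hx, fun w hw v => ?_⟩
  have := hf (f.toHomeo.symm w) (f.toHomeo.map_target hw) ((A⁻¹).1.mulVec v)
  rw [f.toHomeo.right_inv hw, Matrix.mulVec_mulVec, ← Units.val_mul, mul_inv_cancel,
    Units.val_one, Matrix.one_mulVec] at this
  exact this.symm

theorem FlatBundle.iso_equivalence {𝒜 : OrbAtlas m Z} {r : ℕ} :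
    Equivalence (FlatBundle.Iso (𝒜 := 𝒜) (r := r)) where
  refl D := ⟨Homeomorph.refl _, fun _ => rfl, fun p hp q hq => D.2.flat p hp q hq⟩
  symm {D E} := by
    rintro ⟨Φ, h1, h2⟩
    refine ⟨Φ.symm, fun e => (h1 (Φ.symm e)).symm.trans
      (congrArg E.1.proj (Φ.apply_symm_apply e)), fun p hp q hq => ?_⟩
    intro x y hxy
    obtain ⟨f, A, hx, hy, hf⟩ := (h2 q hq p hp).symm x y hxy
    exact ⟨f, A, hx, hy, fun w hw v =>
      (Φ.symm_apply_apply _).symm.trans (congrArg Φ.symm (hf w hw v))⟩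
  trans {D E F} := by
    rintro ⟨Φ, h1, h2⟩ ⟨Ψ, k1, k2⟩
    refine ⟨Φ.trans Ψ, fun e => by simp [h1, k1], fun p hp q hq => ?_⟩
    intro x y hxy
    have hE := E.2.cover (p.1.proj x)
    obtain ⟨o, ho, t, ht⟩ := hE
    obtain ⟨f, A, hx, hfx, hf⟩ := h2 p hp o ho x t ht.symm
    obtain ⟨g, B, ht', hgt, hg⟩ := k2 o ho q hq t y (ht.trans hxy)
    refine ⟨f.trans g, B * A, ?_, ?_, fun w hw v => ?_⟩
    · change x ∈ (f.toHomeo.trans g.toHomeo).source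
      rw [OpenPartialHomeomorph.trans_source]
      refine ⟨hx, ?_⟩
      rw [Set.mem_preimage, hfx]
      exact ht'
    · change g.toHomeo (f.toHomeo x) = y
      rw [hfx, hgt]
    · change w ∈ (f.toHomeo.trans g.toHomeo).source at hw
      rw [OpenPartialHomeomorph.trans_source] at hw
      change q.2 (g.toHomeo (f.toHomeo w), _) = Ψ (Φ (p.2 (w, v)))
      have h3 := hf w hw.1 v
      have h4 := hg (f.toHomeo w) hw.2 (A.1.mulVec v)
      rw [Matrix.mulVec_mulVec, ← Units.val_mul] at h4
      rw [h4]
      exact congrArg Ψ h3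

/-- Isomorphism classes of proper flat orbifold vector bundles. -/
def BundleClass (𝒜 : OrbAtlas m Z) (r : ℕ) :=
  Quotient (⟨FlatBundle.Iso (𝒜 := 𝒜) (r := r), FlatBundle.iso_equivalence⟩ :
    Setoid (FlatBundle 𝒜 r))

/-- The isomorphism class of a bundle. -/
def FlatBundle.cls {𝒜 : OrbAtlas m Z} {r : ℕ} (D : FlatBundle 𝒜 r) : BundleClass 𝒜 r :=
  Quotient.mk _ D

/-! ### Representations -/

/-- Equivalence of representations: conjugation by an invertible matrix. -/
def repSetoid (Γ : Type) [Group Γ] (r : ℕ) : Setoid (Γ →* GL (Fin r) ℂ) where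
  r ρ ρ' := ∃ A : GL (Fin r) ℂ, ∀ γ, ρ' γ = A * ρ γ * A⁻¹
  iseqv := by
    refine ⟨fun ρ => ⟨1, by simp⟩, ?_, ?_⟩
    · rintro ρ ρ' ⟨A, h⟩
      exact ⟨A⁻¹, fun γ => by rw [h]; group⟩
    · rintro ρ ρ' ρ'' ⟨A, h⟩ ⟨B, k⟩
      exact ⟨B * A, fun γ => by rw [k, h]; group⟩

/-- Equivalence classes of representations `Γ → GL_r(ℂ)`. -/
def RepClass (Γ : Type) [Group Γ] (r : ℕ) := Quotient (repSetoid Γ r)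

/-- The equivalence class of a representation. -/
def repCls {Γ : Type} [Group Γ] {r : ℕ} (ρ : Γ →* GL (Fin r) ℂ) : RepClass Γ r :=
  Quotient.mk (repSetoid Γ r) ρ

/-! ### The bundle associated with a representation -/

namespace OrbAtlas

variable {𝒜 : OrbAtlas m Z} {x₀ : 𝒜.Obj} {r : ℕ}

/-- The orbit relation of `Γ` on `X × ℂ^r`, where `γ (x, v) = (γ x, ρ(γ) v)`. -/
def AssocRel (ρ : Pi1 x₀ →* GL (Fin r) ℂ) (p q : UnivCover x₀ × (Fin r → ℂ)) : Prop :=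
  ∃ γ : Pi1 x₀, (γ • p.1, (ρ γ).1.mulVec p.2) = q

/-- The quotient `X ×_ρ ℂ^r` of `X × ℂ^r` by `Γ`, with the quotient topology. -/
def AssocSpace (ρ : Pi1 x₀ →* GL (Fin r) ℂ) : Type := Quot (AssocRel ρ)

instance (ρ : Pi1 x₀ →* GL (Fin r) ℂ) : TopologicalSpace (AssocSpace ρ) :=
  inferInstanceAs (TopologicalSpace (Quot _))

/-- The local trivialization of `X ×_ρ ℂ^r` over a chart domain that is given by the sheet
through `c`: the composition of `sheet c × id`, of the orbit map to `X × ℂ^r`, and of the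
quotient map. -/
def assocTriv (ρ : Pi1 x₀ →* GL (Fin r) ℂ) {i : 𝒜.ι} {a : (𝒜.chart i).dom}
    (c : PathClass x₀ (pt i a)) (p : (𝒜.chart i).dom × (Fin r → ℂ)) : AssocSpace ρ :=
  Quot.mk _ (Quot.mk _ (sheet c p.1), p.2)

/-- The space `X ×_ρ ℂ^r` over `Z` with its canonical local trivializations. -/
def assoc (ρ : Pi1 x₀ →* GL (Fin r) ℂ) : BundleData m Z r where
  total := AssocSpace ρ
  proj := Quot.lift (fun p => p.1.proj) (by
    rintro p q ⟨γ, rfl⟩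
    exact (UnivCover.proj_smul γ p.1).symm)
  charts := {t | ∃ (i : 𝒜.ι) (a : (𝒜.chart i).dom) (c : PathClass x₀ (pt i a)),
    t = ⟨𝒜.chart i, assocTriv ρ c⟩}

end OrbAtlas

/-! ### Parallel transport and holonomy -/

/-- A flat trivialization of the bundle `D` over the charts of the atlas `𝒜`. -/
structure FlatBundle.Trivialization {𝒜 : OrbAtlas m Z} {r : ℕ} (D : FlatBundle 𝒜 r) where
  triv : ∀ i, (𝒜.chart i).dom × (Fin r → ℂ) → D.1.total
  isBundleChart : ∀ i, IsBundleChart D.1.proj (𝒜.chart i) (triv i)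
  flat : ∀ i, ∀ p ∈ D.1.charts, FlatCompatible (𝒜.chart i) (triv i) p.1 p.2

namespace FlatBundle.Trivialization

open OrbAtlas

variable {𝒜 : OrbAtlas m Z} {r : ℕ} {D : FlatBundle 𝒜 r} (τ : D.Trivialization)

/-- `A` is the matrix by which the arrow `g` acts on the fibres: `g` is the germ of a coordinate
transformation `f` such that `(w, v) ↦ (f w, A v)` is the corresponding coordinate
transformation of the total space. -/
def ArrowTransport {x y : 𝒜.Obj} (g : x ⟶ y) (A : GL (Fin r) ℂ) : Prop :=
  ∃ f : LocalArrow x y, Quotient.mk (germSetoid x y) f = g ∧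
    ∀ w ∈ f.map.toHomeo.source, ∀ v : Fin r → ℂ,
      τ.triv y.idx (f.map.toHomeo w, A.1.mulVec v) = τ.triv x.idx (w, v)

/-- `A` is the parallel transport along the `𝒢`-path `(b₁, …, b_k; g₀, …, g_k)`: it is the product
`A_k ⋯ A₀` of the matrices of the arrows. -/
def Transport {x y : 𝒜.Obj} : GPath x y → GL (Fin r) ℂ → Prop
  | .single g₀ _ g₁, A => ∃ A₀ A₁, τ.ArrowTransport g₀ A₀ ∧ τ.ArrowTransport g₁ A₁ ∧ A = A₁ * A₀
  | .cons g₀ _ c, A => ∃ A₀ B, τ.ArrowTransport g₀ A₀ ∧ Transport c B ∧ A = B * A₀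

/-- `ρ` is the holonomy representation: `ρ [c]` is the inverse of the parallel transport along the
loop `c`. (Parallel transport itself reverses products, as `[c][c']` is `c` followed by `c'`.) -/
def IsHolonomy {x₀ : 𝒜.Obj} (ρ : Pi1 x₀ →* GL (Fin r) ℂ) : Prop :=
  ∀ c : GPath x₀ x₀, τ.Transport c (ρ c.cls)⁻¹

end FlatBundle.Trivialization

end FlatOrb

end

noncomputable section

namespace FlatOrb

/-! A flat bundle is determined by its parallel transport. Over a simply connected chart domain it
is trivial, and each arrow of the groupoid then acts by a matrix that is locally constant in the
arrow. The product of these matrices along a 𝒢-path is therefore invariant under the elementary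
moves, and its inverse on loops is the holonomy. Conversely, two sheets of the path space over one
coordinate transformation differ by a loop that is locally constant, so the canonical charts of `X
×_ρ ℂ^r` differ by constant matrices `ρ γ`.

Charts of orbifolds bring isotropy, and two facts control it. A coordinate transformation of a chart
with itself is locally given by a group element (`Transition.exists_eventually_eq_smul`); its proof
linearizes the stabilizer and shows that a differentiable map which chooses pointwise among finitely
many linear maps is one of them. Points with trivial stabilizer are dense (`OrbChart.dense_free`),
by effectiveness. The first fact gives every coordinate transformation a matrix
(`FlatCompatible.exists_flatNear`), the second makes it unique (`FlatNear.unique`); together they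
also show that a map flatly compatible with proper charts is a proper chart
(`IsBundleChart.of_flatCompatible`).

Trivializations over the charts of the atlas exist because the comparison matrices form a locally
constant cocycle on a simply connected space; a section of the associated covering makes it a
coboundary (`exists_locally_constant_trivialization`).

The classification rests on `assoc_iso_iff`: `X ×_ρ ℂ^r` is isomorphic to `D` exactly when `ρ` is
conjugate to the holonomy of `D`. Given an isomorphism, its matrix at the end of a path changes by
parallel transport on the side of `D` and by `ρ` on the side of `X`; comparing the two at a loop
gives the conjugation. Given a conjugating matrix `A`, the class of `([c], v)` is sent to the
transport of `A v` along `c`. Applied to two associated bundles this gives well-definedness and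
injectivity, and applied to the holonomy of an arbitrary `D` it gives surjectivity and the inverse.
-/

/-! ### Local rigidity of finite group actions -/

/-- A function that is differentiable at `0` and at each point coincides with one of finitely many
linear maps coincides with a single one of them. -/
theorem exists_eq_clm_of_mem_finite {E K : Type*} [NormedAddCommGroup E] [NormedSpace ℝ E]
    [Finite K] (D : K → E →L[ℝ] E) {h : E → E} (hd : DifferentiableAt ℝ h 0) {ε : ℝ} (hε : 0 < ε)
    (hc : ContinuousOn h (Metric.ball 0 ε)) (hD : ∀ u ∈ Metric.ball (0 : E) ε, ∃ k, h u = D k u) :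
    ∃ k, ∀ u ∈ Metric.ball (0 : E) ε, h u = D k u := by
  have hL := hd.hasFDerivAt
  set L := fderiv ℝ h 0
  have h0 : h 0 = 0 := by
    obtain ⟨k, hk⟩ := hD 0 (Metric.mem_ball_self hε)
    simp [hk]
  have hball : ∀ u ∈ Metric.ball (0 : E) ε, ∀ t ∈ Set.Ioc (0 : ℝ) 1,
      t • u ∈ Metric.ball (0 : E) ε := by
    intro u hu t ht
    rw [mem_ball_zero_iff] at hu ⊢
    rw [norm_smul, Real.norm_of_nonneg ht.1.le]
    nlinarith [norm_nonneg u, ht.2]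
  have key : ∀ u ∈ Metric.ball (0 : E) ε, h u = L u := by
    intro u hu
    -- The rescaled values along a ray vary continuously inside the finite set of all `D k u`, so
    -- they are constant. Their limit at `0` is the derivative, hence `h` is linear on the ball.
    let q : ℝ → E := fun t => t⁻¹ • h (t • u)
    have hq : ∀ t ∈ Set.Ioc (0 : ℝ) 1, q t = h u := by
      intro t ht
      have hcq : ContinuousOn q (Set.Ioc 0 1) := by
        refine ContinuousOn.smul (continuousOn_inv₀.mono fun t ht => ht.1.ne') ?_
        exact hc.comp (by fun_prop) (hball u hu)
      have hmaps : Set.MapsTo q (Set.Ioc 0 1) (Set.range fun k => D k u) := by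
        intro t ht
        obtain ⟨k, hk⟩ := hD _ (hball u hu t ht)
        exact ⟨k, by simp [q, hk, ht.1.ne']⟩
      have := isPreconnected_Ioc.constant_of_mapsTo (Set.finite_range _).isDiscrete hcq hmaps ht
        (Set.right_mem_Ioc.2 one_pos)
      simpa [q] using this
    have hder : HasDerivAt (fun t : ℝ => h (t • u)) (L u) 0 := by
      have h1 : HasDerivAt (fun t : ℝ => t • u) u 0 := by
        simpa using (hasDerivAt_id (0 : ℝ)).smul_const u
      have h2 : HasFDerivAt h L ((0 : ℝ) • u) := by simpa using hL
      exact h2.comp_hasDerivAt 0 h1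
    have hlim := hder.tendsto_slope_zero_right
    simp only [zero_add, zero_smul, h0, sub_zero] at hlim
    refine tendsto_nhds_unique (tendsto_const_nhds.congr' ?_) hlim
    filter_upwards [Ioc_mem_nhdsGT (zero_lt_one' ℝ)] with t ht using (hq t ht).symm
  -- A real vector space is not a finite union of proper subspaces, so one of these kernels is
  -- everything. Scaling into the ball extends the pointwise hypothesis to all vectors.
  have hcov : ⋃ k, ((LinearMap.ker (L - D k).toLinearMap : Submodule ℝ E) : Set E) = Set.univ := by
    refine Set.eq_univ_of_forall fun u => Set.mem_iUnion.2 ?_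
    obtain ⟨t, ht, htu⟩ : ∃ t : ℝ, 0 < t ∧ t • u ∈ Metric.ball (0 : E) ε := by
      refine ⟨ε / (‖u‖ + 1), by positivity, ?_⟩
      rw [mem_ball_zero_iff, norm_smul, Real.norm_of_nonneg (by positivity), div_mul_eq_mul_div,
        div_lt_iff₀ (by positivity)]
      nlinarith [norm_nonneg u]
    obtain ⟨k, hk⟩ := hD _ htu
    rw [key _ htu, map_smul, map_smul] at hk
    refine ⟨k, ?_⟩
    have := smul_right_injective E ht.ne' hk
    simp [this]
  obtain ⟨k, hk⟩ := Subspace.exists_eq_top_of_iUnion_eq_univ hcov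
  refine ⟨k, fun u hu => ?_⟩
  have : u ∈ LinearMap.ker (L - D k).toLinearMap := hk ▸ Submodule.mem_top
  rw [key u hu]
  simpa [sub_eq_zero] using this

variable {m : ℕ} {Z : Type u} [TopologicalSpace Z]

local notation "𝔼" m => EuclideanSpace ℝ (Fin m)

theorem contDiffAt_of_contMDiffAt {U V : TopologicalSpace.Opens (𝔼 m)} {h : U → V} {x : U}
    (hh : ContMDiffAt 𝓘(ℝ, 𝔼 m) 𝓘(ℝ, 𝔼 m) ∞ h x) :
    ContDiffAt ℝ ∞ (fun w => (h ((U.openPartialHomeomorphSubtypeCoe ⟨x⟩).symm w) : 𝔼 m)) x := by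
  have := (contMDiffAt_iff.1 hh).2
  simp only [extChartAt, modelWithCornersSelf_coe, Set.range_id, contDiffWithinAt_univ] at this
  exact this

instance (c : OrbChart m Z) : ContinuousConstSMul c.G c.dom :=
  ⟨fun g => (c.smooth_smul g).continuous⟩

/-- Cartan's averaging trick: summing the action over the stabilizer, each term corrected by the
inverse derivative, yields an equivariant map with invertible derivative at `x`. The last clause
carries smooth germs at `x` into the linear coordinates as maps differentiable at `0`, which is all
that the rigidity argument needs. -/
theorem OrbChart.exists_linearization (c : OrbChart m Z) (x : c.dom) :
    ∃ (φ : OpenPartialHomeomorph c.dom (𝔼 m)) (D : c.G → (𝔼 m) →L[ℝ] (𝔼 m)),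
      x ∈ φ.source ∧ φ x = 0 ∧
      (∀ k : c.G, k • x = x → ∀ᶠ w in 𝓝 x, φ (k • w) = D k (φ w)) ∧
      ∀ h : c.dom → c.dom, ContMDiffAt 𝓘(ℝ, 𝔼 m) 𝓘(ℝ, 𝔼 m) ∞ h x → h x = x →
        DifferentiableAt ℝ (φ ∘ h ∘ φ.symm) 0 := by
  classical
  let ι := c.dom.openPartialHomeomorphSubtypeCoe ⟨x⟩
  have hιx : ∀ w : c.dom, ι.symm (w : 𝔼 m) = w := fun w => ι.left_inv (by simp [ι])
  have hι : ∀ w ∈ c.dom, (ι.symm w : 𝔼 m) = w := fun w hw => ι.right_inv (by simpa [ι] using hw)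
  have hU : ∀ᶠ w in 𝓝 (x : 𝔼 m), w ∈ c.dom := c.dom.isOpen.mem_nhds x.2
  let F : c.G → (𝔼 m) → (𝔼 m) := fun g w => ((g • ι.symm w : c.dom) : 𝔼 m)
  have hF : ∀ g, ContDiffAt ℝ ∞ (F g) x := fun g =>
    contDiffAt_of_contMDiffAt (c.smooth_smul g x)
  let D : c.G → (𝔼 m) →L[ℝ] (𝔼 m) := fun g => fderiv ℝ (F g) x
  have hFD : ∀ g, HasStrictFDerivAt (F g) (D g) x := fun g => (hF g).hasStrictFDerivAt (by simp)
  let K := MulAction.stabilizer c.G x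
  have : Fintype K := Fintype.ofFinite K
  have hFx : ∀ k : K, F k x = x := by
    intro k
    simp only [F, hιx]
    exact congrArg Subtype.val k.2
  have hDone : D 1 = ContinuousLinearMap.id ℝ _ := by
    have : F 1 =ᶠ[𝓝 (x : 𝔼 m)] id := by
      filter_upwards [hU] with w hw
      simp [F, hι w hw]
    simp only [D, this.fderiv_eq, fderiv_id]
  have hDmul : ∀ k l : K, D (k * l : K) = (D k).comp (D l) := by
    intro k l
    have h1 : F (k * l : K) = F k ∘ F l := by
      funext w
      simp [F, hιx, mul_smul]
    have h2 : HasFDerivAt (F k) (D k) (F l x) := by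
      rw [hFx]; exact (hFD k).hasFDerivAt
    simp only [D, h1]
    exact (h2.comp (x : 𝔼 m) (hFD l).hasFDerivAt).fderiv
  -- The sum is not divided by the order of the stabilizer, so its derivative at `x` is that order
  -- times the identity.
  let Φ : (𝔼 m) → (𝔼 m) := fun w => ∑ k : K, D (k⁻¹ : K) (F k w - x)
  have hcard : (Fintype.card K : ℝ) ≠ 0 := by simp
  let A : (𝔼 m) ≃L[ℝ] (𝔼 m) := ContinuousLinearEquiv.smulLeft (Units.mk0 _ hcard)
  have hΦ : HasStrictFDerivAt Φ (A : (𝔼 m) →L[ℝ] (𝔼 m)) x := by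
    have h1 : HasStrictFDerivAt Φ (∑ k : K, (D (k⁻¹ : K)).comp (D k)) x :=
      HasStrictFDerivAt.fun_sum fun k _ =>
        (D (k⁻¹ : K)).hasStrictFDerivAt.comp (x : 𝔼 m) ((hFD k).sub_const _)
    convert h1 using 1
    ext1 v
    simp_rw [← hDmul, inv_mul_cancel]
    simp [A, hDone, Units.smul_def, Nat.cast_smul_eq_nsmul]
  have hΦdiff : ContDiffAt ℝ ∞ Φ x := by
    refine ContDiffAt.sum fun k _ => ?_
    exact (D (k⁻¹ : K)).contDiff.contDiffAt.comp (x : 𝔼 m) ((hF k).sub contDiffAt_const)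
  have hΦx : Φ x = 0 := by simp [Φ, hFx]
  have hΦK : ∀ (k : K) (w : c.dom), Φ (k.1 • w : c.dom) = D k (Φ w) := by
    intro k w
    simp only [Φ, F, hιx, map_sum]
    refine Fintype.sum_equiv (Equiv.mulRight k) _ _ fun l => ?_
    have h1 : D (l⁻¹ : K) = (D k).comp (D ((l * k)⁻¹ : K)) := by
      rw [← hDmul, mul_inv_rev, mul_inv_cancel_left]
    rw [h1]
    simp [smul_smul]
  let e := hΦ.toOpenPartialHomeomorph Φ
  have hex : (x : 𝔼 m) ∈ e.source := hΦ.mem_toOpenPartialHomeomorph_source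
  have he : ∀ w, e w = Φ w := fun w => rfl
  have hesymm : e.symm 0 = x := by
    rw [← hΦx, ← he]; exact e.left_inv hex
  have h0t : (0 : 𝔼 m) ∈ e.target := by
    rw [← hΦx, ← he]; exact e.map_source hex
  refine ⟨ι.trans e, D, ?_, hΦx, ?_, ?_⟩
  · rw [OpenPartialHomeomorph.trans_source]
    exact ⟨by simp [ι], hex⟩
  · intro k hk
    exact Filter.Eventually.of_forall fun w => hΦK ⟨k, hk⟩ w
  · intro h hh hx
    have h1 : DifferentiableAt ℝ e.symm 0 := by
      refine (e.hasFDerivAt_symm (f' := A) h0t ?_).differentiableAt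
      rw [hesymm]
      exact hΦ.hasFDerivAt
    have h2 : DifferentiableAt ℝ (fun w => (h (ι.symm w) : 𝔼 m)) x :=
      (contDiffAt_of_contMDiffAt hh).differentiableAt (by simp)
    have h3 : DifferentiableAt ℝ Φ ((fun w => (h (ι.symm w) : 𝔼 m)) x) := by
      simp only [hιx, hx]
      exact hΦ.hasFDerivAt.differentiableAt
    have h4 : DifferentiableAt ℝ (Φ ∘ fun w => (h (ι.symm w) : 𝔼 m)) (e.symm 0) := by
      rw [hesymm]; exact h3.comp (x : 𝔼 m) h2
    exact h4.comp 0 h1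

/-- Near a point, a coordinate transformation of a chart with itself is given by an element of the
group of the chart. -/
theorem Transition.exists_eventually_eq_smul {c : OrbChart m Z} (f : Transition c c) {x : c.dom}
    (hx : x ∈ f.toHomeo.source) :
    ∃ g : c.G, g • x = f.toHomeo x ∧ ∀ᶠ w in 𝓝 x, f.toHomeo w = g • w := by
  obtain ⟨g₀, hg₀⟩ := (c.proj_eq_iff x (f.toHomeo x)).1 (f.proj_comp x hx).symm
  obtain ⟨φ, D, hφx, hφ0, hφ, hdiff⟩ := c.exists_linearization x
  let h : c.dom → c.dom := fun w => g₀⁻¹ • f.toHomeo w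
  have hhx : h x = x := by simp [h, ← hg₀]
  have hhc : ContinuousOn h f.toHomeo.source :=
    (continuous_const_smul g₀⁻¹).comp_continuousOn f.toHomeo.continuousOn
  have hhs : ContMDiffAt 𝓘(ℝ, 𝔼 m) 𝓘(ℝ, 𝔼 m) ∞ h x :=
    (c.smooth_smul g₀⁻¹).contMDiffAt.comp x
      (f.smooth.contMDiffAt (f.toHomeo.open_source.mem_nhds hx))
  have hsource : ∀ᶠ w in 𝓝 x, w ∈ f.toHomeo.source := f.toHomeo.open_source.mem_nhds hx
  let K := MulAction.stabilizer c.G x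
  -- Pointwise, `h` is given by some group element. One that moves `x` cannot occur near `x`, since
  -- `h w` stays close to `x` while `g • w` stays close to `g • x`; finiteness of the group gives
  -- one neighbourhood for all such elements.
  have hK : ∀ᶠ w in 𝓝 x, ∃ k : K, h w = k.1 • w := by
    have hne : ∀ g : c.G, g • x ≠ x → ∀ᶠ w in 𝓝 x, g • w ≠ h w := by
      intro g hg
      have h1 : Filter.Tendsto h (𝓝 x) (𝓝 x) := by
        have := hhs.continuousAt
        unfold ContinuousAt at this
        rwa [hhx] at this
      exact (((continuous_const_smul g).tendsto x).prodMk_nhds h1).eventually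
        (isClosed_diagonal.isOpen_compl.mem_nhds hg)
    have hall : ∀ᶠ w in 𝓝 x, ∀ g : c.G, g • x ≠ x → g • w ≠ h w := by
      rw [Filter.eventually_all]
      intro g
      by_cases hg : g • x = x
      · exact Filter.Eventually.of_forall fun w h => absurd hg h
      · exact (hne g hg).mono fun w hw _ => hw
    filter_upwards [hall, hsource] with w hw hws
    obtain ⟨g, hg⟩ := (c.proj_eq_iff w (f.toHomeo w)).1 (f.proj_comp w hws).symm
    have hgw : (g₀⁻¹ * g) • w = h w := by rw [mul_smul, hg]
    refine ⟨⟨g₀⁻¹ * g, ?_⟩, hgw.symm⟩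
    by_contra hcon
    exact hw _ hcon hgw
  have hφK : ∀ᶠ w in 𝓝 x, ∀ k : K, φ (k.1 • w) = D k (φ w) := by
    rw [Filter.eventually_all]
    exact fun k => hφ k k.2
  have hhmem : ∀ᶠ w in 𝓝 x, h w ∈ φ.source :=
    hhs.continuousAt.eventually (by rw [hhx]; exact φ.open_source.mem_nhds hφx)
  have hgood : ∀ᶠ w in 𝓝 x, w ∈ f.toHomeo.source ∧ h w ∈ φ.source ∧
      ∃ k : K, φ (h w) = D k (φ w) := by
    filter_upwards [hK, hφK, hsource, hhmem] with w ⟨k, hk⟩ h2 h3 h4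
    exact ⟨h3, h4, k, by rw [hk, h2 k]⟩
  have hsymm0 : φ.symm 0 = x := by rw [← hφ0]; exact φ.left_inv hφx
  have h0t : (0 : 𝔼 m) ∈ φ.target := by rw [← hφ0]; exact φ.map_source hφx
  have hsc : Filter.Tendsto φ.symm (𝓝 0) (𝓝 x) := by
    have := φ.symm.continuousAt h0t
    unfold ContinuousAt at this
    rwa [hsymm0] at this
  obtain ⟨ε, hε, hball⟩ := Metric.eventually_nhds_iff_ball.1
    ((hsc.eventually hgood).and (φ.open_target.mem_nhds h0t))
  -- In linearizing coordinates the stabilizer acts by the maps `D k`, so the pointwise choice of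
  -- `k` becomes a single choice on a ball.
  obtain ⟨k, hk⟩ := exists_eq_clm_of_mem_finite (fun k : K => D k) (h := φ ∘ h ∘ φ.symm)
    (hdiff h hhs hhx) hε (by
      refine φ.continuousOn.comp (hhc.comp (φ.symm.continuousOn.mono fun u hu => (hball u hu).2)
        fun u hu => (hball u hu).1.1) fun u hu => (hball u hu).1.2.1) (by
      intro u hu
      obtain ⟨-, -, k, hk⟩ := (hball u hu).1
      refine ⟨k, ?_⟩
      rw [φ.right_inv (hball u hu).2] at hk
      exact hk)
  refine ⟨g₀ * k, by rw [mul_smul, k.2, hg₀], ?_⟩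
  have hφ0' : Filter.Tendsto φ (𝓝 x) (𝓝 0) := by
    have := φ.continuousAt hφx
    unfold ContinuousAt at this
    rwa [hφ0] at this
  have hkc : ∀ᶠ w in 𝓝 x, k.1 • w ∈ φ.source :=
    (continuous_const_smul k.1).continuousAt.eventually (by
      exact φ.open_source.mem_nhds (by simpa only [show k.1 • x = x from k.2] using hφx))
  filter_upwards [hφ0'.eventually (Metric.ball_mem_nhds 0 hε), hφK, hhmem, hkc,
    φ.open_source.mem_nhds hφx] with w h1 h2 h3 h4 h5
  have h6 := hk _ h1
  simp only [Function.comp_apply, φ.left_inv h5] at h6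
  rw [← h2 k] at h6
  have h7 := φ.injOn h3 h4 h6
  rw [mul_smul, ← h7, smul_inv_smul]

/-- A group element that fixes all points near some point is trivial. -/
theorem OrbChart.eq_one_of_eventually_fixed {c : OrbChart m Z} {g : c.G} {x : c.dom}
    (h : ∀ᶠ w in 𝓝 x, g • w = w) : g = 1 := by
  let V : Set c.dom := {y | ∀ᶠ w in 𝓝 y, g • w = w}
  have hVo : IsOpen V := isOpen_iff_mem_nhds.2 fun y hy => hy.eventually_nhds
  have hVc : IsClosed V := by
    refine isClosed_of_closure_subset fun y hy => ?_
    have hfix : IsClosed {w : c.dom | g • w = w} :=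
      isClosed_eq (continuous_const_smul g) continuous_id
    have hgy : g • y = y := by
      have : closure V ⊆ {w : c.dom | g • w = w} :=
        hfix.closure_subset_iff.2 fun w hw => hw.self_of_nhds
      exact this hy
    obtain ⟨φ, D, hφy, hφ0, hφ, -⟩ := c.exists_linearization y
    have hgc : ∀ᶠ w in 𝓝 y, g • w ∈ φ.source :=
      (continuous_const_smul g).continuousAt.eventually (by
        exact φ.open_source.mem_nhds (by simpa only [hgy] using hφy))
    obtain ⟨N, hN, hNo, hyN⟩ := eventually_nhds_iff.1
      ((hφ g hgy).and (hgc.and (φ.open_source.mem_nhds hφy)))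
    obtain ⟨w, hwN, hwV⟩ := mem_closure_iff.1 hy N hNo hyN
    -- The linear map `D g` fixes the nonempty open set `φ '' (N ∩ V)`, hence everything.
    have hker : LinearMap.ker (D g - ContinuousLinearMap.id ℝ _).toLinearMap = ⊤ := by
      refine Submodule.eq_top_of_nonempty_interior' _ ⟨φ w, ?_⟩
      refine mem_interior.2 ⟨φ '' (N ∩ V), ?_, φ.isOpen_image_of_subset_source (hNo.inter hVo)
        (fun w hw => (hN w hw.1).2.2), ⟨w, ⟨hwN, hwV⟩, rfl⟩⟩
      rintro _ ⟨w, ⟨hwN, hwV⟩, rfl⟩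
      have := (hN w hwN).1
      rw [hwV.self_of_nhds] at this
      simp [← this]
    refine Filter.mem_of_superset (hNo.mem_nhds hyN) fun w hw => ?_
    have h1 : φ w ∈ LinearMap.ker (D g - ContinuousLinearMap.id ℝ _).toLinearMap :=
      hker ▸ Submodule.mem_top
    have h2 : D g (φ w) = φ w := by simpa [sub_eq_zero] using h1
    exact φ.injOn (hN w hw).2.1 (hN w hw).2.2 ((hN w hw).1.trans h2)
  have := c.connected
  have hV : V = Set.univ := IsClopen.eq_univ ⟨hVc, hVo⟩ ⟨x, h⟩
  refine FaithfulSMul.eq_of_smul_eq_smul (α := c.dom) fun y => ?_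
  have : y ∈ V := hV ▸ Set.mem_univ y
  rw [one_smul]
  exact this.self_of_nhds

/-- The points with trivial stabilizer are dense. -/
theorem OrbChart.dense_free (c : OrbChart m Z) :
    Dense {w : c.dom | ∀ g : c.G, g • w = w → g = 1} := by
  have h1 : {w : c.dom | ∀ g : c.G, g • w = w → g = 1} =
      ⋂ g : {g : c.G // g ≠ 1}, {w : c.dom | g.1 • w = w}ᶜ := by
    ext w
    simp only [Set.mem_ofPred_eq, Set.mem_iInter, Set.mem_compl_iff, Subtype.forall]
    exact forall_congr' fun g => ⟨fun h hg hw => hg (h hw), fun h hw => by_contra fun hg => h hg hw⟩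
  -- Openness is carried along in the induction because density passes to an intersection only when
  -- one of the sets is open.
  have h2 : ∀ s : Set {g : c.G // g ≠ 1}, s.Finite →
      Dense (⋂ g ∈ s, {w : c.dom | g.1 • w = w}ᶜ) ∧ IsOpen (⋂ g ∈ s, {w : c.dom | g.1 • w = w}ᶜ) := by
    intro s hs
    induction s, hs using Set.Finite.induction_on with
    | empty => simp
    | insert _ _ ih =>
      rename_i g s _ _
      have ho : IsOpen {w : c.dom | g.1 • w = w}ᶜ :=
        (isClosed_eq (continuous_const_smul g.1) continuous_id).isOpen_compl
      rw [Set.biInter_insert]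
      refine ⟨Dense.inter_of_isOpen_left ?_ ih.1 ho, ho.inter ih.2⟩
      rw [← interior_eq_empty_iff_dense_compl]
      by_contra hne
      obtain ⟨w, hw⟩ := Set.nonempty_iff_ne_empty.2 hne
      exact g.2 (OrbChart.eq_one_of_eventually_fixed (mem_interior_iff_mem_nhds.1 hw))
  rw [h1]
  simpa using (h2 Set.univ Set.finite_univ).1


/-! ### Coordinate transformations -/

namespace Transition

variable {c d e : OrbChart m Z}

theorem mem_trans_source {f : Transition c d} {g : Transition d e} {x : c.dom} :
    x ∈ (f.trans g).toHomeo.source ↔ x ∈ f.toHomeo.source ∧ f.toHomeo x ∈ g.toHomeo.source := by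
  change x ∈ (f.toHomeo.trans g.toHomeo).source ↔ _
  rw [OpenPartialHomeomorph.trans_source]
  rfl

/-- The coordinate transformation given by a group element. -/
def ofSMul (c : OrbChart m Z) (g : c.G) : Transition c c where
  toHomeo := (Homeomorph.smul g).toOpenPartialHomeomorph
  smooth := (c.smooth_smul g).contMDiffOn
  smooth_symm := (c.smooth_smul g⁻¹).contMDiffOn
  proj_comp := fun _ _ => ((c.proj_eq_iff _ _).2 ⟨g, rfl⟩).symm

theorem mem_ofSMul_source (g : c.G) (x : c.dom) : x ∈ (ofSMul c g).toHomeo.source :=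
  Set.mem_univ x

/-- The restriction of a coordinate transformation to an open set. -/
def restr (f : Transition c d) (s : Set c.dom) (hs : IsOpen s) : Transition c d where
  toHomeo := f.toHomeo.restrOpen s hs
  smooth := f.smooth.mono fun x hx => by
    rw [OpenPartialHomeomorph.restrOpen_source] at hx
    exact hx.1
  smooth_symm := f.smooth_symm.mono fun x hx => hx.1
  proj_comp := fun x hx => f.proj_comp x (by
    rw [OpenPartialHomeomorph.restrOpen_source] at hx
    exact hx.1)

theorem mem_restr_source {f : Transition c d} {s : Set c.dom} {hs : IsOpen s} {x : c.dom} :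
    x ∈ (f.restr s hs).toHomeo.source ↔ x ∈ f.toHomeo.source ∧ x ∈ s := by
  change x ∈ (f.toHomeo.restrOpen s hs).source ↔ _
  rw [OpenPartialHomeomorph.restrOpen_source]
  rfl

theorem tendsto (f : Transition c d) {x : c.dom} (hx : x ∈ f.toHomeo.source) :
    Filter.Tendsto f.toHomeo (𝓝 x) (𝓝 (f.toHomeo x)) :=
  f.toHomeo.continuousAt hx

theorem eventually_mem (f : Transition c d) {x : c.dom} (hx : x ∈ f.toHomeo.source) :
    ∀ᶠ w in 𝓝 x, w ∈ f.toHomeo.source :=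
  f.toHomeo.open_source.mem_nhds hx

end Transition

/-! ### Flat comparison of local trivializations -/

variable {r : ℕ} {T : Type}

theorem mulVec_inv_mulVec (A : GL (Fin r) ℂ) (v : Fin r → ℂ) :
    A.1.mulVec ((A⁻¹).1.mulVec v) = v := by
  rw [Matrix.mulVec_mulVec, ← Units.val_mul, mul_inv_cancel, Units.val_one, Matrix.one_mulVec]

theorem inv_mulVec_mulVec (A : GL (Fin r) ℂ) (v : Fin r → ℂ) :
    (A⁻¹).1.mulVec (A.1.mulVec v) = v := by
  rw [Matrix.mulVec_mulVec, ← Units.val_mul, inv_mul_cancel, Units.val_one, Matrix.one_mulVec]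

theorem mul_mulVec (A B : GL (Fin r) ℂ) (v : Fin r → ℂ) :
    (A * B).1.mulVec v = A.1.mulVec (B.1.mulVec v) := by
  rw [Matrix.mulVec_mulVec, ← Units.val_mul]

theorem one_mulVec (v : Fin r → ℂ) : (1 : GL (Fin r) ℂ).1.mulVec v = v := by
  rw [Units.val_one, Matrix.one_mulVec]

theorem GL_ext_of_mulVec {A B : GL (Fin r) ℂ} (h : ∀ v, A.1.mulVec v = B.1.mulVec v) : A = B :=
  Units.ext (Matrix.mulVec_injective (funext h))

/-- Near `x`, the local trivializations `ψ` and `χ` differ by `(w, v) ↦ (f w, A v)`. -/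
def FlatNear {c d : OrbChart m Z} (f : Transition c d) (ψ : c.dom × (Fin r → ℂ) → T)
    (χ : d.dom × (Fin r → ℂ) → T) (A : GL (Fin r) ℂ) (x : c.dom) : Prop :=
  ∀ᶠ w in 𝓝 x, ∀ v, χ (f.toHomeo w, A.1.mulVec v) = ψ (w, v)

namespace FlatNear

variable {c d e : OrbChart m Z} {f f' : Transition c d} {g : Transition d e}
  {ψ : c.dom × (Fin r → ℂ) → T} {χ : d.dom × (Fin r → ℂ) → T} {θ : e.dom × (Fin r → ℂ) → T}
  {A B : GL (Fin r) ℂ} {x : c.dom}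

theorem apply (h : FlatNear f ψ χ A x) (v : Fin r → ℂ) :
    χ (f.toHomeo x, A.1.mulVec v) = ψ (x, v) :=
  h.self_of_nhds v

theorem eventually (h : FlatNear f ψ χ A x) : ∀ᶠ y in 𝓝 x, FlatNear f ψ χ A y :=
  h.eventually_nhds

theorem congr (h : FlatNear f ψ χ A x) (hf : ∀ᶠ w in 𝓝 x, f.toHomeo w = f'.toHomeo w) :
    FlatNear f' ψ χ A x := by
  filter_upwards [h, hf] with w h1 h2 v
  rw [← h2, h1]

theorem refl : FlatNear (Transition.refl c) ψ ψ 1 x :=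
  Filter.Eventually.of_forall fun w v => by rw [one_mulVec]; rfl

theorem trans (h : FlatNear f ψ χ A x) (k : FlatNear g χ θ B (f.toHomeo x))
    (hx : x ∈ f.toHomeo.source) : FlatNear (f.trans g) ψ θ (B * A) x := by
  filter_upwards [h, (f.tendsto hx).eventually k] with w h1 h2 v
  rw [mul_mulVec, ← h1 v]
  exact h2 _

theorem symm (h : FlatNear f ψ χ A x) (hx : x ∈ f.toHomeo.source) :
    FlatNear f.symm χ ψ A⁻¹ (f.toHomeo x) := by
  have h1 : Filter.Tendsto f.symm.toHomeo (𝓝 (f.toHomeo x)) (𝓝 x) := by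
    have := f.symm.tendsto (f.toHomeo.map_source hx)
    rwa [show f.symm.toHomeo (f.toHomeo x) = x from f.toHomeo.left_inv hx] at this
  have h2 : ∀ᶠ y in 𝓝 (f.toHomeo x), y ∈ f.toHomeo.target :=
    f.toHomeo.open_target.mem_nhds (f.toHomeo.map_source hx)
  filter_upwards [h1.eventually h, h2] with y h3 h4 v
  rw [← h3, mulVec_inv_mulVec]
  exact congrArg (fun y => χ (y, v)) (f.toHomeo.right_inv h4)

/-- A flat comparison at a point gives one on the domain of a restricted transformation. -/
theorem exists_restr (h : FlatNear f ψ χ A x) (hx : x ∈ f.toHomeo.source) :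
    ∃ s : Set c.dom, ∃ hs : IsOpen s, x ∈ (f.restr s hs).toHomeo.source ∧
      ∀ w ∈ (f.restr s hs).toHomeo.source, ∀ v, χ (f.toHomeo w, A.1.mulVec v) = ψ (w, v) := by
  obtain ⟨s, h1, hs, hxs⟩ := eventually_nhds_iff.1 h
  exact ⟨s, hs, Transition.mem_restr_source.2 ⟨hx, hxs⟩,
    fun w hw v => h1 w (Transition.mem_restr_source.1 hw).2 v⟩

theorem of_forall_mem (h : ∀ w ∈ f.toHomeo.source, ∀ v, χ (f.toHomeo w, A.1.mulVec v) = ψ (w, v))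
    (hx : x ∈ f.toHomeo.source) : FlatNear f ψ χ A x :=
  (f.eventually_mem hx).mono h

end FlatNear

/-! ### Existence and uniqueness of the matrix of a flat comparison. -/

section Compatible

variable {c d e : OrbChart m Z} {ψ : c.dom × (Fin r → ℂ) → T} {χ : d.dom × (Fin r → ℂ) → T}
  {θ : e.dom × (Fin r → ℂ) → T}

/-- Shrinking the source of the transformation turns an identity near a point into one on the whole
source, so only germs matter. -/
theorem flatCompatible_iff : FlatCompatible c ψ d χ ↔ ∀ (x : c.dom) (y : d.dom),
    c.proj x = d.proj y → ∃ (f : Transition c d) (A : GL (Fin r) ℂ), x ∈ f.toHomeo.source ∧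
      f.toHomeo x = y ∧ FlatNear f ψ χ A x := by
  refine forall_congr' fun x => forall_congr' fun y => imp_congr_right fun _ => ⟨?_, ?_⟩
  · rintro ⟨f, A, hx, hy, h⟩
    exact ⟨f, A, hx, hy, .of_forall_mem h hx⟩
  · rintro ⟨f, A, hx, hy, h⟩
    obtain ⟨s, hs, hxs, hw⟩ := h.exists_restr hx
    exact ⟨f.restr s hs, A, hxs, hy, hw⟩

/-- Transitivity through an intermediate chart that may vary with the point, since no single chart
need cover the range of `c.proj`. -/
theorem FlatCompatible.trans_of_cover
    (h : ∀ x : c.dom, ∃ (d : OrbChart m Z) (χ : d.dom × (Fin r → ℂ) → T) (t : d.dom),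
      d.proj t = c.proj x ∧ FlatCompatible c ψ d χ ∧ FlatCompatible d χ e θ) :
    FlatCompatible c ψ e θ := by
  rw [flatCompatible_iff]
  intro x y hxy
  obtain ⟨d, χ, t, ht, h1, h2⟩ := h x
  obtain ⟨f, A, hx, rfl, hf⟩ := flatCompatible_iff.1 h1 x t ht.symm
  obtain ⟨g, B, hfx, hy, hg⟩ := flatCompatible_iff.1 h2 (f.toHomeo x) y (ht.trans hxy)
  exact ⟨f.trans g, B * A, Transition.mem_trans_source.2 ⟨hx, hfx⟩, hy, hf.trans hg hx⟩

/-- A group element acts in a proper linear chart by a constant matrix. -/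
theorem flatNear_ofSMul {R : d.G →* GL (Fin r) ℂ}
    (hR : ∀ p q : d.dom × (Fin r → ℂ), χ p = χ q ↔ ∃ g : d.G, (g • p.1, (R g).1.mulVec p.2) = q)
    (g : d.G) (y : d.dom) : FlatNear (Transition.ofSMul d g) χ χ (R g) y :=
  Filter.Eventually.of_forall fun w v => ((hR (w, v) _).2 ⟨g, rfl⟩).symm

/-- A comparison valid near a point holds with the same matrix at nearby points. With existence and
uniqueness at each point of `S`, the matrix is locally constant on `S`. -/
theorem FlatNear.of_isPreconnected {f : Transition c d} {S : Set c.dom} (hS : IsPreconnected S)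
    (hex : ∀ x ∈ S, ∃ A, FlatNear f ψ χ A x)
    (huniq : ∀ x ∈ S, ∀ A B, FlatNear f ψ χ A x → FlatNear f ψ χ B x → A = B)
    {A : GL (Fin r) ℂ} {x y : c.dom} (hx : x ∈ S) (hy : y ∈ S) (h : FlatNear f ψ χ A x) :
    FlatNear f ψ χ A y := by
  have key := hS.induction₂ (fun x y => ∀ A, FlatNear f ψ χ A x ↔ FlatNear f ψ χ A y) ?_ ?_ ?_
    hx hy
  · exact (key A).1 h
  · intro x hx
    obtain ⟨B, hB⟩ := hex x hx
    filter_upwards [nhdsWithin_le_nhds hB.eventually, self_mem_nhdsWithin] with y hBy hy A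
    exact ⟨fun h => huniq x hx B A hB h ▸ hBy, fun h => huniq y hy B A hBy h ▸ hB⟩
  · exact fun x y z _ _ _ h1 h2 A => (h1 A).trans (h2 A)
  · exact fun x y _ _ h A => (h A).symm

/-- Multiplication by an invertible matrix as a homeomorphism. -/
def mulVecHomeomorph (A : GL (Fin r) ℂ) : (Fin r → ℂ) ≃ₜ (Fin r → ℂ) where
  toFun v := A.1.mulVec v
  invFun v := (A⁻¹).1.mulVec v
  left_inv := inv_mulVec_mulVec A
  right_inv := mulVec_inv_mulVec A
  continuous_toFun := continuous_const.matrix_mulVec continuous_id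
  continuous_invFun := continuous_const.matrix_mulVec continuous_id

/-- Locally, two flatly related local trivializations differ by a local homeomorphism. -/
theorem FlatNear.exists_openPartialHomeomorph {f : Transition c d} {A : GL (Fin r) ℂ} {x : c.dom}
    (h : FlatNear f ψ χ A x) (hx : x ∈ f.toHomeo.source) (v : Fin r → ℂ) :
    ∃ E : OpenPartialHomeomorph (c.dom × (Fin r → ℂ)) (d.dom × (Fin r → ℂ)),
      (x, v) ∈ E.source ∧ ψ =ᶠ[𝓝 (x, v)] χ ∘ E := by
  refine ⟨f.toHomeo.prod (mulVecHomeomorph A).toOpenPartialHomeomorph, ⟨hx, trivial⟩, ?_⟩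
  have : ∀ᶠ p : c.dom × (Fin r → ℂ) in 𝓝 (x, v), ∀ v, χ (f.toHomeo p.1, A.1.mulVec v) = ψ (p.1, v) :=
    (continuous_fst.tendsto (x, v)).eventually h
  exact this.mono fun p hp => (hp p.2).symm

variable [TopologicalSpace T] {π : T → Z}

/-- Only isotropy identifies vectors in one fibre of a proper chart, and isotropy is trivial on a
dense set. -/
theorem IsBundleChart.dense_injective (hχ : IsBundleChart π d χ) :
    Dense {y : d.dom | Function.Injective fun v => χ (y, v)} := by
  obtain ⟨R, hR⟩ := hχ.exists_rep
  refine d.dense_free.mono fun y hy v w h => ?_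
  obtain ⟨g, hg⟩ := (hR (y, v) (y, w)).1 h
  simp only [Prod.mk.injEq] at hg
  rw [← hg.2, hy g hg.1, map_one, one_mulVec]

/-- The fibre over `f x` itself may be collapsed by isotropy; the two matrices are compared at a
nearby point where the fibre map is injective. -/
theorem FlatNear.unique (hχ : IsBundleChart π d χ) {f : Transition c d} {x : c.dom}
    (hx : x ∈ f.toHomeo.source) {A B : GL (Fin r) ℂ} (hA : FlatNear f ψ χ A x)
    (hB : FlatNear f ψ χ B x) : A = B := by
  have htend : Filter.Tendsto f.symm.toHomeo (𝓝 (f.toHomeo x)) (𝓝 x) := by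
    have := f.symm.tendsto (f.toHomeo.map_source hx)
    rwa [show f.symm.toHomeo (f.toHomeo x) = x from f.toHomeo.left_inv hx] at this
  have htarget : ∀ᶠ y in 𝓝 (f.toHomeo x), y ∈ f.toHomeo.target :=
    f.toHomeo.open_target.mem_nhds (f.toHomeo.map_source hx)
  obtain ⟨y, h1, h2, hy⟩ := ((mem_closure_iff_frequently.1
    (hχ.dense_injective (f.toHomeo x))).and_eventually
    ((htend.eventually (hA.and hB)).and htarget)).exists
  refine GL_ext_of_mulVec fun v => h1 ?_
  have h3 := (h2.1 v).trans (h2.2 v).symm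
  rwa [show f.toHomeo (f.symm.toHomeo y) = y from f.toHomeo.right_inv hy] at h3

/-- Uniqueness when `χ` is only known to be flatly related to a proper chart. This is what is
available before a map has been shown to be a proper chart. -/
theorem FlatNear.unique_of_flatNear (hθ : IsBundleChart π e θ) {f : Transition c d} {x : c.dom}
    (hx : x ∈ f.toHomeo.source) {g : Transition d e} (hfx : f.toHomeo x ∈ g.toHomeo.source)
    {A B C : GL (Fin r) ℂ} (hC : FlatNear g χ θ C (f.toHomeo x)) (hA : FlatNear f ψ χ A x)
    (hB : FlatNear f ψ χ B x) : A = B :=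
  mul_left_cancel (FlatNear.unique hθ (Transition.mem_trans_source.2 ⟨hx, hfx⟩) (hA.trans hC hx)
    (hB.trans hC hx))

/-- Two coordinate transformations between the same charts differ locally by a group element. -/
theorem Transition.exists_eventually_smul_eq {f f' : Transition c d} {x : c.dom}
    (hx : x ∈ f.toHomeo.source) (hx' : x ∈ f'.toHomeo.source) :
    ∃ g : d.G, ∀ᶠ w in 𝓝 x, g • f'.toHomeo w = f.toHomeo w := by
  have hmem : f'.toHomeo x ∈ (f'.symm.trans f).toHomeo.source :=
    Transition.mem_trans_source.2 ⟨f'.toHomeo.map_source hx', by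
      rw [show f'.symm.toHomeo (f'.toHomeo x) = x from f'.toHomeo.left_inv hx']; exact hx⟩
  obtain ⟨g, -, hg⟩ := Transition.exists_eventually_eq_smul _ hmem
  refine ⟨g, ?_⟩
  filter_upwards [(f'.tendsto hx').eventually hg, f'.eventually_mem hx'] with w h1 h2
  rw [← h1]
  change f.toHomeo (f'.toHomeo.symm (f'.toHomeo w)) = _
  rw [f'.toHomeo.left_inv h2]

/-- Flat compatibility supplies a matrix for some transformation through `x`. By rigidity the given
`f` differs from it by an element of `d.G`, which acts by a constant matrix. -/
theorem FlatCompatible.exists_flatNear (hχ : IsBundleChart π d χ) (h : FlatCompatible c ψ d χ)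
    {f : Transition c d} {x : c.dom} (hx : x ∈ f.toHomeo.source) :
    ∃ A, FlatNear f ψ χ A x := by
  obtain ⟨f', A, hx', -, hA⟩ := flatCompatible_iff.1 h x (f.toHomeo x) (f.proj_comp x hx).symm
  obtain ⟨g, hg⟩ := Transition.exists_eventually_smul_eq hx hx'
  obtain ⟨R, hR⟩ := hχ.exists_rep
  exact ⟨R g * A, (hA.trans (flatNear_ofSMul hR g _) hx').congr hg⟩

/-- The matrix of a flat comparison is constant on preconnected sets. -/
theorem FlatCompatible.flatNear_of_isPreconnected (hχ : IsBundleChart π d χ)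
    (h : FlatCompatible c ψ d χ) {f : Transition c d} {S : Set c.dom} (hS : IsPreconnected S)
    (hSf : S ⊆ f.toHomeo.source) {A : GL (Fin r) ℂ} {x y : c.dom} (hx : x ∈ S) (hy : y ∈ S)
    (hA : FlatNear f ψ χ A x) : FlatNear f ψ χ A y :=
  FlatNear.of_isPreconnected hS (fun _ hx => h.exists_flatNear hχ (hSf hx))
    (fun _ hx _ _ => FlatNear.unique hχ (hSf hx)) hx hy hA

/-- A map that is flatly compatible with proper linear charts is a proper linear chart. -/
theorem IsBundleChart.of_flatCompatible (hπ : ∀ p, π (ψ p) = c.proj p.1)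
    (H : ∀ x : c.dom, ∃ (d : OrbChart m Z) (χ : d.dom × (Fin r → ℂ) → T) (t : d.dom),
      d.proj t = c.proj x ∧ IsBundleChart π d χ ∧ FlatCompatible c ψ d χ) :
    IsBundleChart π c ψ := by
  have hloc : ∀ p, ∃ (d : OrbChart m Z) (χ : d.dom × (Fin r → ℂ) → T)
      (E : OpenPartialHomeomorph (c.dom × (Fin r → ℂ)) (d.dom × (Fin r → ℂ))),
      IsBundleChart π d χ ∧ p ∈ E.source ∧ ψ =ᶠ[𝓝 p] χ ∘ E := by
    rintro ⟨x, v⟩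
    obtain ⟨d, χ, t, ht, hχ, h⟩ := H x
    obtain ⟨f, A, hx, -, hf⟩ := flatCompatible_iff.1 h x t ht.symm
    obtain ⟨E, hE, hψ⟩ := hf.exists_openPartialHomeomorph hx v
    exact ⟨d, χ, E, hχ, hE, hψ⟩
  refine ⟨continuous_iff_continuousAt.2 fun p => ?_, IsOpenMap.of_nhds_le fun p => ?_, hπ, ?_, ?_⟩
  · obtain ⟨d, χ, E, hχ, hE, hψ⟩ := hloc p
    exact (hχ.continuous.continuousAt.comp (E.continuousAt hE)).congr hψ.symm
  · obtain ⟨d, χ, E, hχ, hE, hψ⟩ := hloc p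
    rw [Filter.map_congr hψ, ← Filter.map_map, E.map_nhds_eq hE, hψ.self_of_nhds]
    exact hχ.isOpenMap.nhds_le _
  · rintro e ⟨x, hx⟩
    obtain ⟨d, χ, t, ht, hχ, h⟩ := H x
    obtain ⟨f, A, hxf, -, hf⟩ := flatCompatible_iff.1 h x t ht.symm
    obtain ⟨⟨y, u⟩, rfl⟩ := hχ.range_eq e ⟨t, ht.trans hx⟩
    obtain ⟨R, hR⟩ := hχ.exists_rep
    obtain ⟨g, hg⟩ : ∃ g : d.G, g • y = f.toHomeo x := by
      refine (d.proj_eq_iff _ _).1 ?_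
      rw [f.proj_comp x hxf, hx, hχ.proj_eq]
    refine ⟨(x, (A⁻¹).1.mulVec ((R g).1.mulVec u)), ?_⟩
    rw [← hf.apply, mulVec_inv_mulVec]
    exact ((hR (y, u) _).2 ⟨g, by rw [← hg]⟩).symm
  -- The representation has to be built from comparisons of `ψ` with itself. Uniqueness of their
  -- matrices is borrowed from the proper charts around.
  · have huniq : ∀ (f : Transition c c) (x : c.dom), x ∈ f.toHomeo.source → ∀ A B,
        FlatNear f ψ ψ A x → FlatNear f ψ ψ B x → A = B := by
      intro f x hx A B hA hB
      obtain ⟨d, χ, t, ht, hχ, h⟩ := H (f.toHomeo x)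
      obtain ⟨k, C, hxk, -, hk⟩ := flatCompatible_iff.1 h (f.toHomeo x) t ht.symm
      exact FlatNear.unique_of_flatNear hχ hx hxk hk hA hB
    have hex : ∀ (g : c.G) (x : c.dom), ∃ A, FlatNear (Transition.ofSMul c g) ψ ψ A x := by
      intro g x
      obtain ⟨d, χ, t, ht, hχ, h⟩ := H x
      obtain ⟨f, A, hx, rfl, hf⟩ := flatCompatible_iff.1 h x t ht.symm
      -- Since `f'` is `g⁻¹` followed by `f`, going by `f` and back by `f'` is the action of `g`
      -- near `x`, and both pieces have matrices.
      let f' := (Transition.ofSMul c g).symm.trans f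
      have hinv : f'.toHomeo (g • x) = f.toHomeo x :=
        congrArg f.toHomeo (inv_smul_smul g x)
      have hx' : g • x ∈ f'.toHomeo.source :=
        Transition.mem_trans_source.2 ⟨trivial, by
          change g⁻¹ • g • x ∈ _
          rwa [inv_smul_smul]⟩
      obtain ⟨B, hB⟩ := h.exists_flatNear hχ hx'
      have hB' := hB.symm hx'
      rw [hinv] at hB'
      refine ⟨_, (hf.trans hB' hx).congr ?_⟩
      filter_upwards [f.eventually_mem hx] with w hw
      change g • f.toHomeo.symm (f.toHomeo w) = g • w
      rw [f.toHomeo.left_inv hw]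
    have := c.connected
    have hall : ∀ g : c.G, ∃ A, ∀ x, FlatNear (Transition.ofSMul c g) ψ ψ A x := by
      intro g
      obtain ⟨x⟩ := c.connected.toNonempty
      obtain ⟨A, hA⟩ := hex g x
      exact ⟨A, fun y => FlatNear.of_isPreconnected isPreconnected_univ (fun x _ => hex g x)
        (fun x _ => huniq _ x trivial) trivial trivial hA⟩
    choose R hR using hall
    obtain ⟨x₀⟩ := c.connected.toNonempty
    have hmul : ∀ g h : c.G, R (g * h) = R g * R h := by
      intro g h
      refine huniq (Transition.ofSMul c (g * h)) x₀ trivial _ _ (hR _ _) ?_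
      refine ((hR h x₀).trans (hR g _) trivial).congr (Filter.Eventually.of_forall fun w => ?_)
      exact (mul_smul g h w).symm
    refine ⟨MonoidHom.mk' R hmul, ?_⟩
    rintro ⟨x, v⟩ ⟨y, w⟩
    constructor
    · intro hψ
      obtain ⟨g, rfl⟩ := (c.proj_eq_iff x y).1 (by rw [← hπ (x, v), hψ, hπ])
      rw [← (hR g x).apply v] at hψ
      obtain ⟨d, χ, t, ht, hχ, h⟩ := H (g • x)
      obtain ⟨f, C, hx, rfl, hf⟩ := flatCompatible_iff.1 h (g • x) t ht.symm
      obtain ⟨S, hS⟩ := hχ.exists_rep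
      have h1 := (hf.apply _).trans (hψ.trans (hf.apply w).symm)
      obtain ⟨k, hk⟩ := (hS _ _).1 h1
      simp only [Prod.mk.injEq] at hk
      have hkx : f.toHomeo (g • x) ∈ (Transition.ofSMul d k).toHomeo.source := trivial
      have hfk := hf.trans (flatNear_ofSMul hS k _) hx
      have hx2 : g • x ∈ (f.trans (Transition.ofSMul d k)).toHomeo.source :=
        Transition.mem_trans_source.2 ⟨hx, hkx⟩
      have hval : (f.trans (Transition.ofSMul d k)).toHomeo (g • x) = f.toHomeo (g • x) := hk.1
      -- Conjugating the isotropy element `k` by `f` gives a transformation of `c` fixing `g • x`.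
      -- By rigidity it is an element `g'` of `c.G`, and its matrix is `C⁻¹ * (S k * C)`; then `g' *
      -- g` relates the two given points.
      have h3 := hf.symm hx
      rw [← hval] at h3
      have h4 := hfk.trans h3 hx2
      have hx4 : g • x ∈ ((f.trans (Transition.ofSMul d k)).trans f.symm).toHomeo.source :=
        Transition.mem_trans_source.2 ⟨hx2, by rw [hval]; exact f.toHomeo.map_source hx⟩
      obtain ⟨g', hg'x, hg'⟩ := Transition.exists_eventually_eq_smul _ hx4
      have h5 := huniq (Transition.ofSMul c g') (g • x) trivial _ _ (hR g' _) (h4.congr hg')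
      refine ⟨g' * g, ?_⟩
      simp only [MonoidHom.mk'_apply, hmul, Prod.mk.injEq]
      refine ⟨?_, ?_⟩
      · rw [mul_smul, hg'x]
        change f.toHomeo.symm (k • f.toHomeo (g • x)) = _
        rw [hk.1, f.toHomeo.left_inv hx]
      · rw [h5, mul_mulVec, mul_mulVec, mul_mulVec, hk.2, inv_mulVec_mulVec]
    · rintro ⟨g, hg⟩
      rw [← hg]
      exact ((hR g x).apply v).symm

end Compatible


/-! ### Existence of flat trivializations -/

/-- On a simply connected, locally path connected space, a locally constant cocycle with values in
a group is a coboundary. -/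
theorem exists_locally_constant_trivialization {B J G : Type*} [TopologicalSpace B]
    [SimplyConnectedSpace B] [LocallyPathConnectedSpace B] [Group G] (U : J → Set B)
    (hU : ∀ j, IsOpen (U j)) (hcov : ∀ x, ∃ j, x ∈ U j) (a : J → J → B → G)
    (hloc : ∀ j k x, x ∈ U j → x ∈ U k → ∀ᶠ y in 𝓝 x, a j k y = a j k x)
    (hcomp : ∀ j k l x, x ∈ U j → x ∈ U k → x ∈ U l → a k l x * a j k x = a j l x) :
    ∃ s : J → B → G, (∀ j, ∀ x ∈ U j, ∀ᶠ y in 𝓝 x, s j y = s j x) ∧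
      ∀ j k x, x ∈ U j → x ∈ U k → s k x = a j k x * s j x := by
  let _ : TopologicalSpace G := ⊥
  have _ : DiscreteTopology G := ⟨rfl⟩
  choose idx hidx using hcov
  -- The cocycle acts by left multiplication on the group with the discrete topology. Its total
  -- space is a covering, so the identity of the simply connected base lifts to a global section,
  -- whose local coordinates are the functions `s j`.
  let C : FiberBundleCore J B G :=
    { baseSet := U
      isOpen_baseSet := hU
      indexAt := idx
      mem_baseSet_at := hidx
      coordChange := fun j k x v => a j k x * v
      coordChange_self := fun j x hx v => by
        have := hcomp j j j x hx hx hx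
        rw [mul_eq_right.1 this, one_mul]
      continuousOn_coordChange := by
        rintro j k ⟨x, v⟩ ⟨⟨hj, hk⟩, -⟩
        refine ContinuousAt.continuousWithinAt ?_
        refine (continuousAt_const (y := a j k x * v)).congr ?_
        have h1 : ∀ᶠ p : B × G in 𝓝 (x, v), a j k p.1 = a j k x :=
          (continuous_fst.tendsto (x, v)).eventually (hloc j k x hj hk)
        have h2 : ∀ᶠ p : B × G in 𝓝 (x, v), p.2 = v :=
          (continuous_snd.tendsto (x, v)).eventually (show ∀ᶠ w in 𝓝 v, w = v by simp)
        filter_upwards [h1, h2] with p h1 h2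
        rw [h1, h2]
      coordChange_comp := by
        rintro j k l x ⟨⟨hj, hk⟩, hl⟩ v
        rw [← mul_assoc, hcomp j k l x hj hk hl] }
  have hcover : IsCoveringMap (Bundle.TotalSpace.proj : Bundle.TotalSpace G C.Fiber → B) :=
    FiberBundle.isCoveringMap
  obtain ⟨x₀⟩ : Nonempty B := inferInstance
  obtain ⟨F, ⟨-, hF⟩, -⟩ := hcover.existsUnique_continuousMap_lifts (ContinuousMap.id B) x₀
    (⟨x₀, (1 : G)⟩ : Bundle.TotalSpace G C.Fiber) rfl
  have hFx : ∀ x, (F x).proj = x := fun x => congrFun hF x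
  refine ⟨fun j x => (C.localTriv j (F x)).2, fun j x hx => ?_, fun j k x hj hk => ?_⟩
  · have h1 : ContinuousAt (fun y => (C.localTriv j (F y)).2) x := by
      have h2 : F x ∈ (C.localTriv j).source := by
        rw [FiberBundleCore.mem_localTriv_source]
        change (F x).proj ∈ U j
        rwa [hFx]
      exact continuousAt_snd.comp
        (((C.localTriv j).continuousAt h2).comp F.continuous.continuousAt)
    have h3 := h1.eventually (show ∀ᶠ v in 𝓝 (C.localTriv j (F x)).2, v = (C.localTriv j (F x)).2 by
      simp)
    exact h3
  · let v : G := (F x).snd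
    have h (l : J) : (C.localTriv l (F x)).2 = a (idx x) l x * v := by
      have e : (C.localTriv l (F x)).2 = a (idx (F x).proj) l (F x).proj * v := rfl
      rw [e, hFx]
    refine (h k).trans ?_
    change _ = a j k x * (C.localTriv j (F x)).2
    rw [h, ← mul_assoc, hcomp _ _ _ x (hidx x) hj hk]

/-- Bundle charts pulled back by coordinate transformations trivialize the bundle locally on the
chart domain, with locally constant comparison matrices. Simple connectedness makes this cocycle a
coboundary, and correcting by it glues the pieces. -/
theorem FlatBundle.nonempty_trivialization {𝒜 : OrbAtlas m Z} {r : ℕ} (D : FlatBundle 𝒜 r) :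
    Nonempty D.Trivialization := by
  have key : ∀ i, ∃ ψ : (𝒜.chart i).dom × (Fin r → ℂ) → D.1.total,
      IsBundleChart D.1.proj (𝒜.chart i) ψ ∧
        ∀ p ∈ D.1.charts, FlatCompatible (𝒜.chart i) ψ p.1 p.2 := by
    intro i
    let c := 𝒜.chart i
    have : LocallyPathConnectedSpace c.dom := c.dom.isOpen.locallyPathConnectedSpace
    let J := Σ p : D.1.charts, Transition c p.1.1
    let ψ : J → c.dom × (Fin r → ℂ) → D.1.total := fun j q => j.1.1.2 (j.2.toHomeo q.1, q.2)
    have hc : ∀ j : J, IsBundleChart D.1.proj j.1.1.1 j.1.1.2 := fun j =>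
      D.2.isBundleChart _ j.1.2
    have htriv : ∀ (j : J) x, FlatNear j.2 (ψ j) j.1.1.2 1 x := fun j x =>
      Filter.Eventually.of_forall fun w v => by rw [one_mulVec]
    have hex : ∀ (j k : J) x, x ∈ j.2.toHomeo.source → x ∈ k.2.toHomeo.source →
        ∃ A, FlatNear k.2 (ψ j) k.1.1.2 A x := by
      intro j k x hj hk
      have hjx : j.2.toHomeo x ∈ (j.2.symm.trans k.2).toHomeo.source :=
        Transition.mem_trans_source.2 ⟨j.2.toHomeo.map_source hj, by
          rwa [show j.2.symm.toHomeo (j.2.toHomeo x) = x from j.2.toHomeo.left_inv hj]⟩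
      obtain ⟨A, hA⟩ := (D.2.flat _ j.1.2 _ k.1.2).exists_flatNear (hc k) hjx
      refine ⟨_, ((htriv j x).trans hA hj).congr ?_⟩
      filter_upwards [j.2.eventually_mem hj] with w hw
      exact congrArg k.2.toHomeo (j.2.toHomeo.left_inv hw)
    -- The default value `1` matters only where no comparison exists, which is outside the overlaps.
    let a : J → J → c.dom → GL (Fin r) ℂ := fun j k x =>
      open Classical in if h : ∃ A, FlatNear k.2 (ψ j) k.1.1.2 A x then h.choose else 1
    have ha : ∀ j k x, x ∈ j.2.toHomeo.source → x ∈ k.2.toHomeo.source →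
        FlatNear k.2 (ψ j) k.1.1.2 (a j k x) x := by
      intro j k x hj hk
      have h := hex j k x hj hk
      simp only [a, dif_pos h]
      exact h.choose_spec
    have hcov : ∀ x (p : D.1.charts) (y : p.1.1.dom), c.proj x = p.1.1.proj y →
        ∃ f : Transition c p.1.1, x ∈ f.toHomeo.source ∧ f.toHomeo x = y := by
      intro x p y hxy
      obtain ⟨f, hy, hf⟩ := D.2.compatible _ p.2 i y x hxy.symm
      refine ⟨f.symm, ?_, ?_⟩
      · rw [← hf]; exact f.toHomeo.map_source hy
      · rw [← hf]; exact f.toHomeo.left_inv hy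
    have hcov' : ∀ x, ∃ j : J, x ∈ j.2.toHomeo.source := by
      intro x
      obtain ⟨p, hp, y, hy⟩ := D.2.cover (c.proj x)
      obtain ⟨f, hf, -⟩ := hcov x ⟨p, hp⟩ y hy.symm
      exact ⟨⟨⟨p, hp⟩, f⟩, hf⟩
    obtain ⟨s, hs, hsa⟩ := exists_locally_constant_trivialization
      (fun j : J => j.2.toHomeo.source) (fun j => j.2.toHomeo.open_source) hcov' a (by
        intro j k x hj hk
        filter_upwards [(ha j k x hj hk).eventually, j.2.eventually_mem hj,
          k.2.eventually_mem hk] with y h1 h2 h3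
        exact (ha j k y h2 h3).unique (hc k) h3 h1) (by
        intro j k l x hj hk hl
        refine FlatNear.unique (f := l.2) (hc l) hl (ψ := ψ j) ?_ (ha j l x hj hl)
        filter_upwards [ha j k x hj hk, ha k l x hk hl] with w h1 h2 v
        rw [mul_mulVec, h2, ← h1])
    choose idx hidx using hcov'
    -- The coboundary relation makes the value independent of the index chosen at each point; that
    -- is `hΨ`.
    let Ψ : c.dom × (Fin r → ℂ) → D.1.total := fun q =>
      ψ (idx q.1) (q.1, (s (idx q.1) q.1).1.mulVec q.2)
    have hΨ : ∀ (j : J) x, x ∈ j.2.toHomeo.source → ∀ v,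
        Ψ (x, v) = j.1.1.2 (j.2.toHomeo x, (s j x).1.mulVec v) := by
      intro j x hx v
      rw [hsa (idx x) j x (hidx x) hx, mul_mulVec, (ha (idx x) j x (hidx x) hx).apply]
    have hΨnear : ∀ (j : J) x, x ∈ j.2.toHomeo.source →
        FlatNear j.2 Ψ j.1.1.2 (s j x) x := by
      intro j x hx
      filter_upwards [hs j x hx, j.2.eventually_mem hx] with w h1 h2 v
      rw [hΨ j w h2, h1]
    have hflat : ∀ p ∈ D.1.charts, FlatCompatible c Ψ p.1 p.2 := by
      intro p hp
      rw [flatCompatible_iff]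
      intro x y hxy
      obtain ⟨f, hf, hfx⟩ := hcov x ⟨p, hp⟩ y hxy
      exact ⟨f, _, hf, hfx, hΨnear ⟨⟨p, hp⟩, f⟩ x hf⟩
    refine ⟨Ψ, IsBundleChart.of_flatCompatible (fun q => ?_) (fun x => ?_), hflat⟩
    · rw [show Ψ q = (idx q.1).1.1.2 _ from rfl, (hc (idx q.1)).proj_eq]
      exact (idx q.1).2.proj_comp _ (hidx q.1)
    · obtain ⟨p, hp, y, hy⟩ := D.2.cover (c.proj x)
      exact ⟨p.1, p.2, y, hy, D.2.isBundleChart p hp, hflat p hp⟩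
  choose ψ h1 h2 using key
  exact ⟨⟨ψ, h1, h2⟩⟩


/-! ### Parallel transport and holonomy -/

namespace FlatBundle.Trivialization

open OrbAtlas

variable {𝒜 : OrbAtlas m Z} {r : ℕ}
  {D : FlatBundle 𝒜 r} (τ : D.Trivialization)

theorem flatCompatible (i j : 𝒜.ι) :
    FlatCompatible (𝒜.chart i) (τ.triv i) (𝒜.chart j) (τ.triv j) := by
  refine FlatCompatible.trans_of_cover fun x => ?_
  obtain ⟨p, hp, t, ht⟩ := D.2.cover ((𝒜.chart i).proj x)
  exact ⟨p.1, p.2, t, ht, τ.flat i p hp, (τ.flat j p hp).symm⟩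

/-- The matrix condition depends only on the germ, so it can be tested on any representative. -/
theorem arrowTransport_mk_iff {x y : 𝒜.Obj} (f : LocalArrow x y) (A : GL (Fin r) ℂ) :
    τ.ArrowTransport (Quotient.mk (germSetoid x y) f : x ⟶ y) A ↔
      FlatNear f.map (τ.triv x.idx) (τ.triv y.idx) A x.pos := by
  constructor
  · rintro ⟨f', hf', h⟩
    exact (FlatNear.of_forall_mem h f'.mem).congr (Quotient.exact hf')
  · intro h
    obtain ⟨s, hs, hxs, hw⟩ := h.exists_restr f.mem
    exact ⟨⟨f.map.restr s hs, hxs, f.map_eq⟩,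
      Quotient.sound (Filter.Eventually.of_forall fun _ => rfl), hw⟩

theorem existsUnique_arrowTransport {x y : 𝒜.Obj} (g : x ⟶ y) : ∃! A, τ.ArrowTransport g A := by
  induction g using Quotient.inductionOn with
  | h f =>
    simp only [arrowTransport_mk_iff]
    obtain ⟨A, hA⟩ := (τ.flatCompatible x.idx y.idx).exists_flatNear (τ.isBundleChart y.idx) f.mem
    exact ⟨A, hA, fun B hB => hB.unique (τ.isBundleChart y.idx) f.mem hA⟩

/-- The matrix by which an arrow acts on the fibres. -/
def arrowMat {x y : 𝒜.Obj} (g : x ⟶ y) : GL (Fin r) ℂ :=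
  (τ.existsUnique_arrowTransport g).choose

theorem arrowTransport_iff {x y : 𝒜.Obj} (g : x ⟶ y) (A : GL (Fin r) ℂ) :
    τ.ArrowTransport g A ↔ A = τ.arrowMat g :=
  ⟨fun h => (τ.existsUnique_arrowTransport g).choose_spec.2 A h,
    fun h => h ▸ (τ.existsUnique_arrowTransport g).choose_spec.1⟩

theorem flatNear_iff {x y : 𝒜.Obj} (f : LocalArrow x y) (A : GL (Fin r) ℂ) :
    FlatNear f.map (τ.triv x.idx) (τ.triv y.idx) A x.pos ↔
      A = τ.arrowMat (Quotient.mk (germSetoid x y) f : x ⟶ y) :=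
  (τ.arrowTransport_mk_iff f A).symm.trans (τ.arrowTransport_iff _ A)

theorem flatNear_arrowMat {x y : 𝒜.Obj} (f : LocalArrow x y) :
    FlatNear f.map (τ.triv x.idx) (τ.triv y.idx)
      (τ.arrowMat (Quotient.mk (germSetoid x y) f : x ⟶ y)) x.pos :=
  (τ.flatNear_iff f _).2 rfl

theorem triv_arrowMat {x y : 𝒜.Obj} (g : x ⟶ y) (v : Fin r → ℂ) :
    τ.triv y.idx (y.pos, (τ.arrowMat g).1.mulVec v) = τ.triv x.idx (x.pos, v) := by
  induction g using Quotient.inductionOn with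
  | h f =>
    have h := (τ.flatNear_arrowMat f).apply v
    rwa [f.map_eq] at h

@[simp]
theorem arrowMat_id (x : 𝒜.Obj) : τ.arrowMat (𝟙 x) = 1 :=
  ((τ.flatNear_iff (LocalArrow.refl x) 1).1 FlatNear.refl).symm

@[simp]
theorem arrowMat_comp {x y z : 𝒜.Obj} (g : x ⟶ y) (h : y ⟶ z) :
    τ.arrowMat (g ≫ h) = τ.arrowMat h * τ.arrowMat g := by
  induction g using Quotient.inductionOn with
  | h f =>
    induction h using Quotient.inductionOn with
    | h k =>
      have hk := τ.flatNear_arrowMat k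
      rw [← f.map_eq] at hk
      exact ((τ.flatNear_iff (f.comp k) _).1 ((τ.flatNear_arrowMat f).trans hk f.mem)).symm

@[simp]
theorem arrowMat_inv {x y : 𝒜.Obj} (g : x ⟶ y) :
    τ.arrowMat (Groupoid.inv g) = (τ.arrowMat g)⁻¹ := by
  have h := τ.arrowMat_comp g (Groupoid.inv g)
  rw [Groupoid.comp_inv, arrowMat_id] at h
  exact eq_inv_of_mul_eq_one_left h.symm

theorem flatNear_germ {i j : 𝒜.ι} (f : Transition (𝒜.chart i) (𝒜.chart j))
    {x : (𝒜.chart i).dom} (hx : x ∈ f.toHomeo.source) :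
    FlatNear f (τ.triv i) (τ.triv j) (τ.arrowMat (germ f x hx)) x :=
  τ.flatNear_arrowMat (x := pt i x) (y := pt j (f.toHomeo x)) ⟨f, hx, rfl⟩

theorem arrowMat_germ_eq {i j : 𝒜.ι} {f : Transition (𝒜.chart i) (𝒜.chart j)}
    {x : (𝒜.chart i).dom} (hx : x ∈ f.toHomeo.source) {A : GL (Fin r) ℂ}
    (hA : FlatNear f (τ.triv i) (τ.triv j) A x) : τ.arrowMat (germ f x hx) = A :=
  (τ.flatNear_germ f hx).unique (τ.isBundleChart j) hx hA

/-- The matrices of the germs of a coordinate transformation are constant along paths. -/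
theorem arrowMat_germ_of_path {i j : 𝒜.ι} (f : Transition (𝒜.chart i) (𝒜.chart j))
    {a b : (𝒜.chart i).dom} (p : Path a b) (hp : ∀ t, p t ∈ f.toHomeo.source)
    (ha : a ∈ f.toHomeo.source) (hb : b ∈ f.toHomeo.source) :
    τ.arrowMat (germ f b hb) = τ.arrowMat (germ f a ha) := by
  refine τ.arrowMat_germ_eq hb ?_
  refine (τ.flatCompatible i j).flatNear_of_isPreconnected (τ.isBundleChart j)
    (isPreconnected_range p.continuous) (by rintro _ ⟨t, rfl⟩; exact hp t) ⟨0, p.source⟩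
    ⟨1, p.target⟩ (τ.flatNear_germ f ha)

/-- The matrix of an arrow is a locally constant function of the arrow. -/
theorem arrowMat_eq_of_continuous {γ : I → ArrowSpace 𝒜} (hγ : Continuous γ) (s t : I) :
    τ.arrowMat (γ s).arrow = τ.arrowMat (γ t).arrow := by
  -- For the discrete topology, continuity means local constancy, and a continuous map from the
  -- connected interval is constant. The germ topology reduces continuity to the germs of one
  -- coordinate transformation at a time.
  let _ : TopologicalSpace (GL (Fin r) ℂ) := ⊥
  have _ : DiscreteTopology (GL (Fin r) ℂ) := ⟨rfl⟩
  have h : Continuous fun g : ArrowSpace 𝒜 => τ.arrowMat g.arrow := by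
    refine continuous_iSup_dom.2 fun i => continuous_iSup_dom.2 fun j =>
      continuous_iSup_dom.2 fun f => continuous_coinduced_dom.2 ?_
    refine continuous_iff_continuousAt.2 fun x => ?_
    refine (continuousAt_const (y := τ.arrowMat (germ f x.1 x.2))).congr ?_
    filter_upwards [continuous_subtype_val.continuousAt.eventually
      (τ.flatNear_germ f x.2).eventually] with y hy
    exact (τ.arrowMat_germ_eq y.2 hy).symm
  exact PreconnectedSpace.constant inferInstance (h.comp hγ)

/-- The parallel transport along a `𝒢`-path. -/
def pathMat {x y : 𝒜.Obj} : GPath x y → GL (Fin r) ℂ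
  | .single g₀ _ g₁ => τ.arrowMat g₁ * τ.arrowMat g₀
  | .cons g₀ _ c => pathMat c * τ.arrowMat g₀

theorem transport_iff {x y : 𝒜.Obj} (c : GPath x y) (A : GL (Fin r) ℂ) :
    τ.Transport c A ↔ A = τ.pathMat c := by
  induction c generalizing A with
  | single g₀ p g₁ => simp [Transport, pathMat, arrowTransport_iff]
  | cons g₀ p c ih => simp [Transport, pathMat, arrowTransport_iff, ih]

theorem pathMat_pre {w x y : 𝒜.Obj} (h : w ⟶ x) (c : GPath x y) :
    τ.pathMat (c.pre h) = τ.pathMat c * τ.arrowMat h := by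
  cases c <;> simp [GPath.pre, pathMat, mul_assoc]

theorem pathMat_trans {x y z : 𝒜.Obj} (c : GPath x y) (d : GPath y z) :
    τ.pathMat (c.trans d) = τ.pathMat d * τ.pathMat c := by
  induction c with
  | single g₀ p g₁ => simp [GPath.trans, pathMat, pathMat_pre, mul_assoc]
  | cons g₀ p c ih => simp [GPath.trans, pathMat, ih, mul_assoc]

/-- The first arrows are allowed to differ, because in the induction the role of the first arrow is
taken over by an intermediate arrow that moves with the parameter. -/
theorem pathMat_eval {i : 𝒜.ι} {a : I → (𝒜.chart i).dom} {w x y : 𝒜.Obj} (F : PathFamily a y)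
    (s t : I) (g : w ⟶ pt i (a s)) (h : x ⟶ pt i (a t)) (hgh : τ.arrowMat g = τ.arrowMat h) :
    τ.pathMat (F.eval s g) = τ.pathMat (F.eval t h) := by
  induction F generalizing w x with
  | last p hp k => simp [PathFamily.eval, pathMat, hgh]
  | step p hp k hk F ih =>
    simp only [PathFamily.eval, pathMat]
    rw [ih (k s) (k t) (τ.arrowMat_eq_of_continuous hk s t), hgh]

/-- In a translation the germs of `h` at both ends of the path have the same matrix, so the two new
factors cancel. -/
theorem pathMat_eq_of_step {x y : 𝒜.Obj} {c d : GPath x y} (h : GPath.Step c d) :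
    τ.pathMat c = τ.pathMat d := by
  induction h with
  | subdivide_single g₀ p q g₁ => simp [pathMat]
  | subdivide_cons g₀ p q d => simp [pathMat]
  | translate_single g₀ p g₁ h hs ha hb hc =>
    simp only [pathMat, arrowMat_comp, arrowMat_inv, τ.arrowMat_germ_of_path h p hs ha hb,
      mul_assoc, inv_mul_cancel_left]
  | translate_cons g₀ p d h hs ha hb hc =>
    simp only [pathMat, pathMat_pre, arrowMat_comp, arrowMat_inv,
      τ.arrowMat_germ_of_path h p hs ha hb, mul_assoc, inv_mul_cancel_left]
  | congr_cons g₀ p h ih => simp [pathMat, ih]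
  | homotopy g₀ F => exact τ.pathMat_eval F 0 1 g₀ g₀ rfl

/-- The parallel transport along a homotopy class of `𝒢`-paths. -/
def classMat {x y : 𝒜.Obj} (c : PathClass x y) : GL (Fin r) ℂ :=
  Quot.lift τ.pathMat (fun _ _ h => τ.pathMat_eq_of_step h) c

theorem classMat_cls {x y : 𝒜.Obj} (c : GPath x y) : τ.classMat c.cls = τ.pathMat c := rfl

theorem classMat_comp {x y z : 𝒜.Obj} (c : PathClass x y) (d : PathClass y z) :
    τ.classMat (c.comp d) = τ.classMat d * τ.classMat c := by
  induction c using Quot.inductionOn with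
  | h c =>
    induction d using Quot.inductionOn with
    | h d => exact τ.pathMat_trans c d

@[simp]
theorem classMat_ofArrow {x y : 𝒜.Obj} (g : x ⟶ y) :
    τ.classMat (GPath.ofArrow g).cls = τ.arrowMat g := by
  simp [classMat_cls, GPath.ofArrow, pathMat]

@[simp]
theorem classMat_refl (x : 𝒜.Obj) : τ.classMat (GPath.refl x).cls = 1 := by
  simp [GPath.refl]

@[simp]
theorem classMat_ofPath {i : 𝒜.ι} {a b : (𝒜.chart i).dom} (p : Path a b) :
    τ.classMat (GPath.ofPath p).cls = 1 := by
  simp [classMat_cls, GPath.ofPath, pathMat]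

/-- The holonomy representation. -/
def holonomy (x₀ : 𝒜.Obj) : Pi1 x₀ →* GL (Fin r) ℂ where
  toFun γ := (τ.classMat γ)⁻¹
  map_one' := by
    rw [inv_eq_one]
    exact τ.classMat_refl x₀
  map_mul' γ δ := by
    rw [← mul_inv_rev]
    exact congrArg _ (τ.classMat_comp γ δ)

theorem holonomy_apply {x₀ : 𝒜.Obj} (γ : Pi1 x₀) : τ.holonomy x₀ γ = (τ.classMat γ)⁻¹ := rfl

theorem isHolonomy_holonomy (x₀ : 𝒜.Obj) : τ.IsHolonomy (τ.holonomy x₀) := fun c => by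
  rw [transport_iff]
  exact inv_inv (τ.classMat c.cls)

end FlatBundle.Trivialization


namespace OrbAtlas

variable {𝒜 : OrbAtlas m Z}

/-! ### Homotopy classes of paths in chart domains and of arrows -/

/-- The arrow given by the germ of `f` at `x`, with a target that is only propositionally the
value of `f`. -/
def germTo {i j : 𝒜.ι} (f : Transition (𝒜.chart i) (𝒜.chart j)) {x : (𝒜.chart i).dom}
    {y : (𝒜.chart j).dom} (hx : x ∈ f.toHomeo.source) (hy : f.toHomeo x = y) : pt i x ⟶ pt j y :=
  Quotient.mk (germSetoid (pt i x) (pt j y)) ⟨f, hx, hy⟩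

theorem exists_eq_germTo {i j : 𝒜.ι} {x : (𝒜.chart i).dom} {y : (𝒜.chart j).dom}
    (g : pt i x ⟶ pt j y) : ∃ (f : Transition (𝒜.chart i) (𝒜.chart j))
      (hx : x ∈ f.toHomeo.source) (hy : f.toHomeo x = y), g = germTo f hx hy := by
  induction g using Quotient.inductionOn with
  | h f => exact ⟨f.map, f.mem, f.map_eq, rfl⟩

theorem germTo_eq_germTo {i j : 𝒜.ι} {f f' : Transition (𝒜.chart i) (𝒜.chart j)}
    {x : (𝒜.chart i).dom} {y : (𝒜.chart j).dom} (hx : x ∈ f.toHomeo.source)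
    (hy : f.toHomeo x = y) (hx' : x ∈ f'.toHomeo.source) (hy' : f'.toHomeo x = y)
    (h : ∀ᶠ w in 𝓝 x, f.toHomeo w = f'.toHomeo w) : germTo f hx hy = germTo f' hx' hy' :=
  Quotient.sound h

theorem exists_hom {y z : 𝒜.Obj} (h : (𝒜.chart y.idx).proj y.pos = (𝒜.chart z.idx).proj z.pos) :
    Nonempty (y ⟶ z) := by
  obtain ⟨f, hy, hz⟩ := 𝒜.compatible y.idx z.idx y.pos z.pos h
  exact ⟨germTo f hy hz⟩

namespace PathClass

theorem comp_inv {x y : 𝒜.Obj} (c : PathClass x y) : c.comp c.inv = (GPath.refl x).cls := by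
  induction c using Quot.inductionOn with
  | h c => exact comp_symm c

theorem ofArrow_comp_cls {x y z : 𝒜.Obj} (g : x ⟶ y) (c : GPath y z) :
    (GPath.ofArrow g).cls.comp c.cls = (c.pre g).cls := by
  have := id_comp (c.pre g).cls
  rw [← this]
  change (GPath.cons (𝟙 x) (Path.refl x.pos) (c.pre g)).cls =
    (GPath.cons (𝟙 x) (Path.refl x.pos) ((c.pre g).pre (𝟙 x))).cls
  rw [GPath.pre_id]

theorem ofArrow_comp_ofArrow {x y z : 𝒜.Obj} (g : x ⟶ y) (h : y ⟶ z) :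
    (GPath.ofArrow g).cls.comp (GPath.ofArrow h).cls = (GPath.ofArrow (g ≫ h)).cls := by
  rw [ofArrow_comp_cls, ← single_const]
  simp [GPath.ofArrow, GPath.pre]

theorem comp_ofArrow_ofArrow {w x y z : 𝒜.Obj} (c : PathClass w x) (g : x ⟶ y) (h : y ⟶ z) :
    (c.comp (GPath.ofArrow g).cls).comp (GPath.ofArrow h).cls =
      c.comp (GPath.ofArrow (g ≫ h)).cls := by
  rw [comp_assoc, ofArrow_comp_ofArrow]

theorem ofPath_comp_ofArrow {i : 𝒜.ι} {a b : (𝒜.chart i).dom} {y : 𝒜.Obj} (p : Path a b)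
    (g : pt i b ⟶ y) :
    (GPath.ofPath p).cls.comp (GPath.ofArrow g).cls = (GPath.single (𝟙 _) p g).cls := by
  have h := single_comp_single (𝟙 (pt i a)) p (𝟙 _) (𝟙 _) (Path.refl b) g (Category.comp_id _)
  exact h.trans (single_homotopic _ ⟨Path.Homotopy.transRefl p⟩ g)

theorem ofPath_comp_ofPath {i : 𝒜.ι} {a b c : (𝒜.chart i).dom} (p : Path a b) (q : Path b c) :
    (GPath.ofPath p).cls.comp (GPath.ofPath q).cls = (GPath.ofPath (p.trans q)).cls :=
  single_comp_single _ _ _ _ _ _ (Category.comp_id _)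

/-- Chart domains of the atlas are simply connected. -/
theorem ofPath_eq {i : 𝒜.ι} {a b : (𝒜.chart i).dom} (p q : Path a b) :
    (GPath.ofPath p).cls = (GPath.ofPath q).cls :=
  single_homotopic _ (SimplyConnectedSpace.paths_homotopic p q) _

/-- A path in the source of a coordinate transformation can be translated by it. -/
theorem ofPath_comp_germTo {i j : 𝒜.ι} (f : Transition (𝒜.chart i) (𝒜.chart j))
    {a b : (𝒜.chart i).dom} {a' b' : (𝒜.chart j).dom} (p : Path a b)
    (hp : ∀ t, p t ∈ f.toHomeo.source) (ha : a ∈ f.toHomeo.source) (hb : b ∈ f.toHomeo.source)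
    (ha' : f.toHomeo a = a') (hb' : f.toHomeo b = b') (q : Path a' b') :
    (GPath.ofPath p).cls.comp (GPath.ofArrow (germTo f hb hb')).cls =
      (GPath.ofArrow (germTo f ha ha')).cls.comp (GPath.ofPath q).cls := by
  subst ha' hb'
  have hc : ContinuousOn f.toHomeo (Set.range p) :=
    f.toHomeo.continuousOn.mono (by rintro _ ⟨t, rfl⟩; exact hp t)
  rw [ofPath_eq q (p.map' hc), ofPath_comp_ofArrow, ofArrow_comp_cls]
  have h : (GPath.single (𝟙 _) p (germ f b hb)).cls = _ :=
    Quot.sound (GPath.Step.translate_single (𝟙 _) p (germ f b hb) f hp ha hb hc)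
  rw [Groupoid.inv_comp, Category.id_comp] at h
  simp only [GPath.ofPath, GPath.pre, Category.comp_id]
  exact h

theorem comp_right_injective {x y z : 𝒜.Obj} (d : PathClass y z) :
    Function.Injective fun c : PathClass x y => c.comp d := by
  intro c c' h
  have h' := congrArg (fun e => comp e d.inv) h
  simpa only [comp_assoc, comp_inv, comp_id] using h'

end PathClass

variable {x₀ : 𝒜.Obj}

/-- The fundamental group acts on the classes of paths by composition at the starting point. -/
instance (y : 𝒜.Obj) : MulAction (Pi1 x₀) (PathClass x₀ y) where
  smul γ c := PathClass.comp γ c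
  one_smul := PathClass.id_comp
  mul_smul γ δ c := PathClass.comp_assoc γ δ c

theorem smul_comp {y z : 𝒜.Obj} (γ : Pi1 x₀) (c : PathClass x₀ y) (d : PathClass y z) :
    (γ • c).comp d = γ • c.comp d :=
  PathClass.comp_assoc γ c d

/-! ### The sheets of the space of paths -/

/-- The class `c` followed by a path in the chart domain. -/
def extend {i : 𝒜.ι} {a : (𝒜.chart i).dom} (c : PathClass x₀ (pt i a)) (b : (𝒜.chart i).dom) :
    PathClass x₀ (pt i b) :=
  c.comp (GPath.ofPath (PathConnectedSpace.somePath a b)).cls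

section Extend

variable {i j : 𝒜.ι} {a b : (𝒜.chart i).dom}

theorem extend_eq (c : PathClass x₀ (pt i a)) (p : Path a b) :
    extend c b = c.comp (GPath.ofPath p).cls := by
  rw [extend, PathClass.ofPath_eq _ p]

@[simp]
theorem extend_self (c : PathClass x₀ (pt i a)) : extend c a = c := by
  rw [extend_eq c (Path.refl a)]
  exact PathClass.comp_id c

theorem extend_extend (c : PathClass x₀ (pt i a)) (b b' : (𝒜.chart i).dom) :
    extend (extend c b) b' = extend c b' := by
  rw [extend, extend, PathClass.comp_assoc, PathClass.ofPath_comp_ofPath, ← extend_eq]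

theorem extend_smul (γ : Pi1 x₀) (c : PathClass x₀ (pt i a)) (b : (𝒜.chart i).dom) :
    extend (γ • c) b = γ • extend c b :=
  smul_comp _ _ _

/-- Germs of one transformation can be applied before or after moving along a path in its source.
This is how the arrows act continuously on sheets. -/
theorem extend_comp_germTo (f : Transition (𝒜.chart i) (𝒜.chart j)) (c : PathClass x₀ (pt i a))
    {x w : (𝒜.chart i).dom} {y z : (𝒜.chart j).dom} (h : JoinedIn f.toHomeo.source x w)
    (hy : f.toHomeo x = y) (hz : f.toHomeo w = z) :
    (extend c w).comp (GPath.ofArrow (germTo f h.target_mem hz)).cls =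
      extend ((extend c x).comp (GPath.ofArrow (germTo f h.source_mem hy)).cls) z := by
  obtain ⟨p, hp⟩ := h
  rw [← extend_extend c x w, extend_eq _ p, PathClass.comp_assoc,
    PathClass.ofPath_comp_germTo f p hp _ _ hy hz (PathConnectedSpace.somePath y z),
    ← PathClass.comp_assoc]
  rfl

end Extend

theorem sheet_extend {i : 𝒜.ι} {a : (𝒜.chart i).dom} (c : PathClass x₀ (pt i a))
    (b : (𝒜.chart i).dom) : sheet (extend c b) = sheet c :=
  funext fun w => congrArg (PathSpace.mk (pt i w)) (extend_extend c b w)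

theorem continuous_sheet {i : 𝒜.ι} {a : (𝒜.chart i).dom} (c : PathClass x₀ (pt i a)) :
    Continuous (sheet c) :=
  continuous_iSup_rng (i := i) (continuous_iSup_rng (i := a) (continuous_iSup_rng (i := c)
    continuous_coinduced_rng))

theorem isOpen_pathSpace_iff {V : Set (PathSpace x₀)} : IsOpen V ↔
    ∀ (i : 𝒜.ι) (a : (𝒜.chart i).dom) (c : PathClass x₀ (pt i a)), IsOpen (sheet c ⁻¹' V) := by
  simp only [isOpen_iSup_iff, isOpen_coinduced]

/-- A sheet is determined by any one of its points, so two sheets coincide or are disjoint. -/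
theorem sheet_eq_of_apply_eq {i : 𝒜.ι} {a b u v : (𝒜.chart i).dom} {c : PathClass x₀ (pt i a)}
    {d : PathClass x₀ (pt i b)} (h : sheet c u = sheet d v) : u = v ∧ sheet c = sheet d := by
  have h1 : pt i u = pt i v := congrArg PathSpace.target h
  obtain rfl : u = v := by simpa using h1
  have h2 : extend c u = extend d u := by
    have : (⟨pt i u, extend c u⟩ : PathSpace x₀) = ⟨pt i u, extend d u⟩ := h
    simpa using this
  exact ⟨rfl, by rw [← sheet_extend c u, h2, sheet_extend]⟩

theorem isOpenMap_sheet {i : 𝒜.ι} {a : (𝒜.chart i).dom} (c : PathClass x₀ (pt i a)) :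
    IsOpenMap (sheet c) := by
  intro U hU
  rw [isOpen_pathSpace_iff]
  intro j b d
  rw [isOpen_iff_mem_nhds]
  rintro v ⟨u, hu, huv⟩
  obtain rfl : i = j := congrArg (fun e : PathSpace x₀ => e.target.idx) huv
  obtain ⟨rfl, hcd⟩ := sheet_eq_of_apply_eq huv
  exact Filter.mem_of_superset (hU.mem_nhds hu) fun w hw => ⟨w, hw, congrFun hcd w⟩

/-! ### The universal covering orbifold -/

theorem PathSpace.rel_equivalence : Equivalence (PathSpace.Rel x₀) where
  refl c := ⟨𝟙 _, (PathClass.comp_id _).symm⟩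
  symm := by
    rintro c d ⟨g, hg⟩
    refine ⟨Groupoid.inv g, ?_⟩
    rw [hg, PathClass.comp_ofArrow_ofArrow, Groupoid.comp_inv]
    exact (PathClass.comp_id _).symm
  trans := by
    rintro c d e ⟨g, hg⟩ ⟨h, hh⟩
    exact ⟨g ≫ h, by rw [hh, hg, PathClass.comp_ofArrow_ofArrow]⟩

theorem eventually_joinedIn {i : 𝒜.ι} {s : Set (𝒜.chart i).dom} (hs : IsOpen s)
    {x : (𝒜.chart i).dom} (hx : x ∈ s) : ∀ᶠ w in 𝓝 x, JoinedIn s x w := by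
  have : LocallyPathConnectedSpace (𝒜.chart i).dom :=
    (𝒜.chart i).dom.isOpen.locallyPathConnectedSpace
  exact pathComponentIn_mem_nhds (hs.mem_nhds hx)

/-- An arrow out of a point extends to nearby points as germs of one transformation, and following
it lands in the same sheet. Hence the saturation of an open set is open. -/
theorem isOpenMap_mk_univCover :
    IsOpenMap (Quot.mk _ : PathSpace x₀ → UnivCover x₀) := by
  intro V hV
  change IsOpen (Quot.mk (PathSpace.Rel x₀) ⁻¹' (Quot.mk (PathSpace.Rel x₀) '' V))
  rw [isOpen_pathSpace_iff]
  intro j b d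
  rw [isOpen_iff_mem_nhds]
  rintro y ⟨⟨⟨i, x⟩, e⟩, heV, he⟩
  obtain ⟨g, hg⟩ := (PathSpace.rel_equivalence.quot_mk_eq_iff _ _).1 he.symm
  obtain ⟨f, hy, hx, rfl⟩ := exists_eq_germTo g
  have hyt := f.tendsto hy
  rw [hx] at hyt
  have heq : sheet e x = ⟨pt i x, e⟩ := congrArg (PathSpace.mk (pt i x)) (extend_self e)
  have hV' : ∀ᶠ u in 𝓝 x, sheet e u ∈ V :=
    (continuous_sheet e).continuousAt.eventually (hV.mem_nhds (by rwa [heq]))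
  filter_upwards [eventually_joinedIn f.toHomeo.open_source hy, hyt.eventually hV'] with w h1 h2
  refine ⟨_, h2, ((PathSpace.rel_equivalence.quot_mk_eq_iff _ _).2
    ⟨germTo f h1.target_mem rfl, ?_⟩).symm⟩
  exact (congrArg (fun e => extend e _) hg).trans (extend_comp_germTo f d h1 hx rfl).symm

/-- The loop `γ` carries the sheet of `c` to the sheet of `γ • c`. -/
theorem continuous_smul_univCover (γ : Pi1 x₀) :
    Continuous fun x : UnivCover x₀ => γ • x := by
  refine continuous_coinduced_dom (f := Quot.mk (PathSpace.Rel x₀)).2 ?_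
  refine continuous_iSup_dom.2 fun i => continuous_iSup_dom.2 fun a =>
    continuous_iSup_dom.2 fun c => continuous_coinduced_dom.2 ?_
  have h : Continuous fun w => (Quot.mk _ (sheet (γ • c) w) : UnivCover x₀) :=
    continuous_quot_mk.comp (continuous_sheet _)
  refine h.congr fun w => ?_
  exact congrArg (fun e => (Quot.mk _ (⟨pt i w, e⟩ : PathSpace x₀) : UnivCover x₀))
    (extend_smul γ c w)

/-! ### The associated bundle -/

variable {r : ℕ} (ρ : Pi1 x₀ →* GL (Fin r) ℂ)

theorem assocRel_equivalence : Equivalence (AssocRel ρ) where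
  refl p := ⟨1, by rw [one_smul, map_one, one_mulVec]⟩
  symm := by
    rintro p q ⟨γ, rfl⟩
    exact ⟨γ⁻¹, by rw [inv_smul_smul, map_inv, inv_mulVec_mulVec]⟩
  trans := by
    rintro p q s ⟨γ, rfl⟩ ⟨δ, rfl⟩
    exact ⟨δ * γ, by rw [mul_smul, map_mul, mul_mulVec]⟩

/-- The saturation of an open set is the union of its preimages under the homeomorphic action of all
loops. -/
theorem isOpenMap_mk_assocSpace :
    IsOpenMap (Quot.mk _ : UnivCover x₀ × (Fin r → ℂ) → AssocSpace ρ) := by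
  intro V hV
  change IsOpen (Quot.mk (AssocRel ρ) ⁻¹' (Quot.mk (AssocRel ρ) '' V))
  have h : (Quot.mk _ ⁻¹' (Quot.mk (AssocRel ρ) '' V) : Set (UnivCover x₀ × (Fin r → ℂ))) =
      ⋃ γ : Pi1 x₀, (fun p => (γ • p.1, (ρ γ).1.mulVec p.2)) ⁻¹' V := by
    ext p
    simp only [Set.mem_preimage, Set.mem_image, Set.mem_iUnion]
    constructor
    · rintro ⟨q, hq, hqp⟩
      obtain ⟨γ, hγ⟩ := ((assocRel_equivalence ρ).quot_mk_eq_iff _ _).1 hqp.symm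
      exact ⟨γ, by rwa [hγ]⟩
    · rintro ⟨γ, hγ⟩
      exact ⟨_, hγ, (((assocRel_equivalence ρ).quot_mk_eq_iff _ _).2 ⟨γ, rfl⟩).symm⟩
  rw [h]
  exact isOpen_iUnion fun γ => hV.preimage
    (((continuous_smul_univCover γ).comp continuous_fst).prodMk
      (continuous_const.matrix_mulVec continuous_snd))

/-- The point of the associated bundle given by a class of paths and a vector. -/
def assocMk {y : 𝒜.Obj} (c : PathClass x₀ y) (v : Fin r → ℂ) : AssocSpace ρ :=
  Quot.mk _ (Quot.mk _ ⟨y, c⟩, v)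

theorem exists_eq_assocMk (e : AssocSpace ρ) :
    ∃ (y : 𝒜.Obj) (c : PathClass x₀ y) (v : Fin r → ℂ), e = assocMk ρ c v := by
  induction e using Quot.inductionOn with
  | h p =>
    obtain ⟨x, v⟩ := p
    induction x using Quot.inductionOn with
    | h c => exact ⟨c.target, c.pathClass, v, rfl⟩

theorem assoc_proj_assocMk {y : 𝒜.Obj} (c : PathClass x₀ y) (v : Fin r → ℂ) :
    (assoc ρ).proj (assocMk ρ c v) = (𝒜.chart y.idx).proj y.pos := rfl

theorem assocMk_eq_iff {y z : 𝒜.Obj} (c : PathClass x₀ y) (d : PathClass x₀ z)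
    (v w : Fin r → ℂ) : assocMk ρ c v = assocMk ρ d w ↔ ∃ (γ : Pi1 x₀) (g : y ⟶ z),
      d = (γ • c).comp (GPath.ofArrow g).cls ∧ (ρ γ).1.mulVec v = w := by
  refine ((assocRel_equivalence ρ).quot_mk_eq_iff _ _).trans (exists_congr fun γ => ?_)
  rw [exists_and_right]
  exact Prod.mk_inj.trans (and_congr_left' (PathSpace.rel_equivalence.quot_mk_eq_iff _ _))

theorem assocMk_ofArrow {y z : 𝒜.Obj} (c : PathClass x₀ y) (g : y ⟶ z) (v : Fin r → ℂ) :
    assocMk ρ (c.comp (GPath.ofArrow g).cls) v = assocMk ρ c v := by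
  refine ((assocMk_eq_iff ρ _ _ _ _).2 ⟨1, g, ?_, by rw [map_one, one_mulVec]⟩).symm
  rw [one_smul]

theorem assocMk_comp {y : 𝒜.Obj} (γ : Pi1 x₀) (c : PathClass x₀ y) (v : Fin r → ℂ) :
    assocMk ρ (γ • c) ((ρ γ).1.mulVec v) = assocMk ρ c v := by
  refine ((assocMk_eq_iff ρ _ _ _ _).2 ⟨γ, 𝟙 _, ?_, rfl⟩).symm
  exact (PathClass.comp_id _).symm

theorem assocTriv_apply {i : 𝒜.ι} {a : (𝒜.chart i).dom} (c : PathClass x₀ (pt i a))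
    (x : (𝒜.chart i).dom) (v : Fin r → ℂ) : assocTriv ρ c (x, v) = assocMk ρ (extend c x) v := rfl

/-! ### The canonical charts of the associated bundle. -/

section Triv

variable {i j : 𝒜.ι} {a : (𝒜.chart i).dom} {b : (𝒜.chart j).dom} (c : PathClass x₀ (pt i a))
  (d : PathClass x₀ (pt j b))

theorem continuous_assocTriv : Continuous (assocTriv ρ c) := by
  refine continuous_quot_mk.comp (Continuous.prodMk ?_ continuous_snd)
  exact (continuous_quot_mk.comp (continuous_sheet c)).comp continuous_fst

theorem isOpenMap_assocTriv : IsOpenMap (assocTriv ρ c) :=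
  (isOpenMap_mk_assocSpace ρ).comp
    ((isOpenMap_mk_univCover.comp (isOpenMap_sheet c)).prodMap IsOpenMap.id)

/-- The loop by which the translate of a sheet differs from another sheet. -/
theorem exists_loop {x y : 𝒜.Obj} (c : PathClass x₀ x) (d : PathClass x₀ y) (g : x ⟶ y) :
    ∃ γ : Pi1 x₀, d = (γ • c).comp (GPath.ofArrow g).cls := by
  refine ⟨d.comp (c.comp (GPath.ofArrow g).cls).inv, ?_⟩
  change d = (PathClass.comp (d.comp (c.comp _).inv) c).comp _
  rw [PathClass.comp_assoc, PathClass.comp_assoc, PathClass.inv_comp, PathClass.comp_id]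

theorem loop_unique {x y : 𝒜.Obj} {γ δ : Pi1 x₀} {c : PathClass x₀ x} {g : x ⟶ y}
    (h : (γ • c).comp (GPath.ofArrow g).cls =
      (δ • c).comp (GPath.ofArrow g).cls) : γ = δ :=
  PathClass.comp_right_injective c (PathClass.comp_right_injective _ h)

variable {c d}

/-- The loop relating two sheets over `f` does not change along a path in the source of `f`.
Flatness of the canonical charts comes from this. -/
theorem extend_eq_of_joinedIn {f : Transition (𝒜.chart i) (𝒜.chart j)} {x w : (𝒜.chart i).dom}
    (h : JoinedIn f.toHomeo.source x w) {y z : (𝒜.chart j).dom} (hy : f.toHomeo x = y)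
    (hz : f.toHomeo w = z) {γ : Pi1 x₀}
    (hγ : extend d y = (γ • extend c x).comp
      (GPath.ofArrow (germTo f h.source_mem hy)).cls) :
    extend d z = (γ • extend c w).comp
      (GPath.ofArrow (germTo f h.target_mem hz)).cls := by
  rw [← extend_extend d y z, hγ, ← extend_smul, ← extend_smul, extend_comp_germTo f _ h hy hz]

theorem flatNear_assocTriv {f : Transition (𝒜.chart i) (𝒜.chart j)} {x : (𝒜.chart i).dom}
    (hx : x ∈ f.toHomeo.source) {y : (𝒜.chart j).dom} (hy : f.toHomeo x = y) {γ : Pi1 x₀}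
    (hγ : extend d y = (γ • extend c x).comp (GPath.ofArrow (germTo f hx hy)).cls) :
    FlatNear f (assocTriv ρ c) (assocTriv ρ d) (ρ γ) x := by
  filter_upwards [eventually_joinedIn f.toHomeo.open_source hx] with w hw v
  rw [assocTriv_apply, assocTriv_apply, extend_eq_of_joinedIn hw hy rfl hγ, assocMk_ofArrow,
    assocMk_comp]

variable (c d)

theorem flatCompatible_assocTriv :
    FlatCompatible (𝒜.chart i) (assocTriv ρ c) (𝒜.chart j) (assocTriv ρ d) := by
  rw [flatCompatible_iff]
  intro x y hxy
  obtain ⟨f, hx, hy⟩ := 𝒜.compatible i j x y hxy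
  obtain ⟨γ, hγ⟩ := exists_loop (extend c x) (extend d y) (germTo f hx hy)
  exact ⟨f, ρ γ, hx, hy, flatNear_assocTriv ρ hx hy hγ⟩

/-- Each element `g` of the chart group lifts to a loop `L g` that carries the sheet to its
translate by `g`. The isotropy representation of the chart is `ρ` composed with the homomorphism
`L`. -/
theorem isBundleChart_assocTriv : IsBundleChart (assoc ρ).proj (𝒜.chart i) (assocTriv ρ c) := by
  refine ⟨continuous_assocTriv ρ c, isOpenMap_assocTriv ρ c, fun p => rfl, ?_, ?_⟩
  · rintro e ⟨x, hx⟩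
    obtain ⟨y, d, v, rfl⟩ := exists_eq_assocMk ρ e
    rw [assoc_proj_assocMk] at hx
    obtain ⟨g⟩ := exists_hom (y := y) (z := pt i x) hx.symm
    obtain ⟨γ, hγ⟩ := exists_loop d (extend c x) g
    exact ⟨(x, (ρ γ).1.mulVec v), by rw [assocTriv_apply, hγ, assocMk_ofArrow, assocMk_comp]⟩
  · have hjoin : ∀ (g : (𝒜.chart i).G) (x y : (𝒜.chart i).dom),
        JoinedIn (Transition.ofSMul (𝒜.chart i) g).toHomeo.source x y := fun g x y =>
      ⟨PathConnectedSpace.somePath x y, fun _ => Transition.mem_ofSMul_source g _⟩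
    have hex : ∀ g : (𝒜.chart i).G, ∃ γ : Pi1 x₀, ∀ (x y : (𝒜.chart i).dom) (h : g • x = y),
        extend c y = (γ • extend c x).comp
          (GPath.ofArrow (germTo (Transition.ofSMul _ g) (Transition.mem_ofSMul_source g x) h)).cls := by
      intro g
      obtain ⟨γ, hγ⟩ := exists_loop (extend c a) (extend c (g • a))
        (germTo (Transition.ofSMul _ g) (Transition.mem_ofSMul_source g a) rfl)
      exact ⟨γ, fun x y h => extend_eq_of_joinedIn (hjoin g a x) rfl h hγ⟩
    choose L hL using hex
    have hmul : ∀ g h, L (g * h) = L g * L h := by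
      intro g h
      -- Both sides carry `extend c a` to the extension to `(g * h) • a`: the germ of `g * h` is the
      -- germ of `h` followed by that of `g`.
      refine loop_unique (c := extend c a) (g := germTo (y := (g * h) • a)
        (Transition.ofSMul _ (g * h)) (Transition.mem_ofSMul_source _ a) rfl) ?_
      rw [← hL (g * h) a _ rfl, hL g (h • a) ((g * h) • a) (smul_smul g h a), hL h a _ rfl,
        ← smul_comp, PathClass.comp_ofArrow_ofArrow, smul_smul]
      refine congrArg₂ PathClass.comp rfl (congrArg (fun g => (GPath.ofArrow g).cls) ?_)
      exact Quotient.sound (Filter.Eventually.of_forall fun w => smul_smul g h w)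
    refine ⟨ρ.comp (MonoidHom.mk' L hmul), ?_⟩
    rintro ⟨x, v⟩ ⟨y, w⟩
    refine (assocMk_eq_iff ρ (extend c x) (extend c y) v w).trans ?_
    simp only [MonoidHom.comp_apply, MonoidHom.mk'_apply, Prod.mk.injEq]
    constructor
    · rintro ⟨γ, k, hγ, hv⟩
      -- By rigidity the arrow between the two points is the germ of a group element `g`; uniqueness
      -- of the loop then forces `γ = L g`.
      obtain ⟨f, hx, rfl, rfl⟩ := exists_eq_germTo k
      obtain ⟨g, hgx, hg⟩ := Transition.exists_eventually_eq_smul f hx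
      refine ⟨g, hgx, ?_⟩
      have h1 := hL g x _ hgx
      rw [hγ, germTo_eq_germTo hx rfl (Transition.mem_ofSMul_source g x) hgx hg] at h1
      rw [← loop_unique h1, hv]
    · rintro ⟨g, hg, hv⟩
      exact ⟨L g, _, hL g x y hg, hv⟩

end Triv

/-! ### The associated bundle is a proper flat bundle -/

/-- On a connected orbifold, every point is the end point of some path. -/
theorem nonempty_pathClass [ConnectedSpace Z] (x₀ y : 𝒜.Obj) : Nonempty (PathClass x₀ y) := by
  let S : Set Z := {z | ∃ y : 𝒜.Obj, Nonempty (PathClass x₀ y) ∧ (𝒜.chart y.idx).proj y.pos = z}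
  have hS : ∀ y : 𝒜.Obj, (𝒜.chart y.idx).proj y.pos ∈ S → Nonempty (PathClass x₀ y) := by
    rintro y ⟨y', ⟨c⟩, h⟩
    obtain ⟨g⟩ := exists_hom h
    exact ⟨c.comp (GPath.ofArrow g).cls⟩
  have hext : ∀ (i : 𝒜.ι) (x y : (𝒜.chart i).dom), Nonempty (PathClass x₀ (pt i x)) →
      Nonempty (PathClass x₀ (pt i y)) := fun i x y ⟨c⟩ => ⟨extend c y⟩
  have hnhds : ∀ (i : 𝒜.ι) (x : (𝒜.chart i).dom),
      Set.range (𝒜.chart i).proj ∈ 𝓝 ((𝒜.chart i).proj x) := fun i x =>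
    (𝒜.chart i).isOpenMap_proj.isOpen_range.mem_nhds ⟨x, rfl⟩
  -- Chart domains are path connected, so the image of a chart lies entirely in `S` or entirely
  -- outside it.
  have hclopen : IsClopen S := by
    constructor
    · rw [← isOpen_compl_iff, isOpen_iff_mem_nhds]
      intro z hz
      obtain ⟨i, x, rfl⟩ := 𝒜.cover z
      refine Filter.mem_of_superset (hnhds i x) ?_
      rintro _ ⟨y, rfl⟩ hy
      exact hz ⟨pt i x, hext i y x (hS (pt i y) hy), rfl⟩
    · rw [isOpen_iff_mem_nhds]
      rintro _ ⟨⟨i, x⟩, hx, rfl⟩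
      refine Filter.mem_of_superset (hnhds i x) ?_
      rintro _ ⟨y, rfl⟩
      exact ⟨pt i y, hext i x y hx, rfl⟩
  have huniv := hclopen.eq_univ ⟨_, x₀, ⟨(GPath.refl x₀).cls⟩, rfl⟩
  exact hS y (huniv ▸ Set.mem_univ _)

end OrbAtlas

/-- A space with proper linear charts over a Hausdorff space is Hausdorff. -/
theorem t2Space_of_isBundleChart [T2Space Z] {r : ℕ}
    {T : Type} [TopologicalSpace T] {π : T → Z} (hπ : Continuous π)
    (h : ∀ z : Z, ∃ (c : OrbChart m Z) (ψ : c.dom × (Fin r → ℂ) → T), z ∈ Set.range c.proj ∧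
      IsBundleChart π c ψ) : T2Space T := by
  refine ⟨fun e e' hne => ?_⟩
  by_cases hz : π e = π e'
  · obtain ⟨c, ψ, hc, hψ⟩ := h (π e)
    obtain ⟨p, rfl⟩ := hψ.range_eq e hc
    obtain ⟨q, rfl⟩ := hψ.range_eq e' (hz ▸ hc)
    obtain ⟨R, hR⟩ := hψ.exists_rep
    let act : c.G → c.dom × (Fin r → ℂ) → c.dom × (Fin r → ℂ) := fun g p =>
      (g • p.1, (R g).1.mulVec p.2)
    have hact : ∀ g, Continuous (act g) := fun g =>
      (continuous_fst.const_smul g).prodMk (continuous_const.matrix_mulVec continuous_snd)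
    have hg : ∀ g, ∃ U V : Set (c.dom × (Fin r → ℂ)), IsOpen U ∧ IsOpen V ∧ act g p ∈ U ∧ q ∈ V ∧
        Disjoint U V := fun g => t2_separation fun hgp => hne ((hR p q).2 ⟨g, hgp⟩)
    choose U V hU hV hpU hqV hUV using hg
    -- Finiteness of the chart group keeps the intersections open, and no orbit meets both of them.
    refine ⟨ψ '' ⋂ g, act g ⁻¹' U g, ψ '' ⋂ g, V g,
      hψ.isOpenMap _ (isOpen_iInter_of_finite fun g => (hU g).preimage (hact g)),
      hψ.isOpenMap _ (isOpen_iInter_of_finite hV),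
      ⟨p, Set.mem_iInter.2 hpU, rfl⟩, ⟨q, Set.mem_iInter.2 hqV, rfl⟩, ?_⟩
    rw [Set.disjoint_left]
    rintro _ ⟨s, hs, rfl⟩ ⟨t, ht, hst⟩
    obtain ⟨g, rfl⟩ := (hR s t).1 hst.symm
    exact Set.disjoint_left.1 (hUV g) (Set.mem_iInter.1 hs g) (Set.mem_iInter.1 ht g)
  · obtain ⟨U, V, hU, hV, hzU, hzV, hUV⟩ := t2_separation hz
    exact ⟨_, _, hU.preimage hπ, hV.preimage hπ, hzU, hzV, hUV.preimage π⟩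

namespace OrbAtlas

variable {𝒜 : OrbAtlas m Z} {x₀ : 𝒜.Obj} {r : ℕ}

theorem assoc_continuous_proj (ρ : Pi1 x₀ →* GL (Fin r) ℂ) : Continuous (assoc ρ).proj := by
  refine continuous_coinduced_dom.2 ?_
  have h : Continuous (UnivCover.proj : UnivCover x₀ → Z) := by
    refine continuous_coinduced_dom.2 ?_
    refine continuous_iSup_dom.2 fun i => continuous_iSup_dom.2 fun a =>
      continuous_iSup_dom.2 fun c => continuous_coinduced_dom.2 ?_
    exact (𝒜.chart i).continuous_proj
  exact h.comp continuous_fst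

theorem exists_assoc_chart [ConnectedSpace Z] (ρ : Pi1 x₀ →* GL (Fin r) ℂ) (i : 𝒜.ι) :
    ∃ (a : (𝒜.chart i).dom) (c : PathClass x₀ (pt i a)),
      (⟨𝒜.chart i, assocTriv ρ c⟩ : Σ c : OrbChart m Z, c.dom × (Fin r → ℂ) → AssocSpace ρ) ∈
        (assoc ρ).charts := by
  obtain ⟨a⟩ := (𝒜.chart i).connected.toNonempty
  obtain ⟨c⟩ := nonempty_pathClass x₀ (pt i a)
  exact ⟨a, c, i, a, c, rfl⟩

/-- One sheet per chart already covers the bundle. As the atlas is countable, this yields second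
countability, and it allows continuity and openness to be tested on these charts. -/
theorem isOpenQuotientMap_assocTriv (ρ : Pi1 x₀ →* GL (Fin r) ℂ) {a : ∀ i, (𝒜.chart i).dom}
    (c : ∀ i, PathClass x₀ (pt i (a i))) :
    IsOpenQuotientMap fun p : Σ i : 𝒜.ι, (𝒜.chart i).dom × (Fin r → ℂ) =>
      assocTriv ρ (c p.1) p.2 where
  surjective := by
    intro e
    obtain ⟨i, x, hx⟩ := 𝒜.cover ((assoc ρ).proj e)
    obtain ⟨p, hp⟩ := (isBundleChart_assocTriv ρ (c i)).range_eq e ⟨x, hx⟩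
    exact ⟨⟨i, p⟩, hp⟩
  continuous := continuous_sigma fun i => continuous_assocTriv ρ (c i)
  isOpenMap := isOpenMap_sigma.2 fun i => isOpenMap_assocTriv ρ (c i)

/-- The bundle associated with a representation is a proper flat orbifold vector bundle. -/
theorem isProperFlat_assoc [T2Space Z] [ConnectedSpace Z] (ρ : Pi1 x₀ →* GL (Fin r) ℂ) :
    IsProperFlat 𝒜 (assoc ρ) where
  continuous_proj := assoc_continuous_proj ρ
  hausdorff := by
    refine t2Space_of_isBundleChart (m := m) (r := r) (assoc_continuous_proj ρ) fun z => ?_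
    obtain ⟨i, x, rfl⟩ := 𝒜.cover z
    obtain ⟨a, c, -⟩ := exists_assoc_chart ρ i
    exact ⟨_, _, ⟨x, rfl⟩, isBundleChart_assocTriv ρ c⟩
  secondCountable := by
    choose a c _ using exists_assoc_chart ρ
    have h := isOpenQuotientMap_assocTriv ρ c
    exact h.isQuotientMap.secondCountableTopology h.isOpenMap
  cover := by
    intro z
    obtain ⟨i, x, rfl⟩ := 𝒜.cover z
    obtain ⟨a, c, h⟩ := exists_assoc_chart ρ i
    exact ⟨_, h, x, rfl⟩
  compatible := by
    rintro p ⟨i, a, c, rfl⟩ j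
    exact 𝒜.compatible i j
  isBundleChart := by
    rintro p ⟨i, a, c, rfl⟩
    exact isBundleChart_assocTriv ρ c
  flat := by
    rintro p ⟨i, a, c, rfl⟩ q ⟨j, b, d, rfl⟩
    exact flatCompatible_assocTriv ρ c d

end OrbAtlas


/-! ### The correspondence between bundles and representations -/

section Correspondence

open OrbAtlas FlatBundle.Trivialization

variable {𝒜 : OrbAtlas m Z} {x₀ : 𝒜.Obj} {r : ℕ}
  {ρ : Pi1 x₀ →* GL (Fin r) ℂ} {D : FlatBundle 𝒜 r} (τ : D.Trivialization)

theorem OrbAtlas.PathClass.single_eq {x y : 𝒜.Obj} {i : 𝒜.ι} {a b : (𝒜.chart i).dom}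
    (g₀ : x ⟶ pt i a) (p : Path a b) (g₁ : pt i b ⟶ y) :
    (GPath.single g₀ p g₁).cls =
      ((GPath.ofArrow g₀).cls.comp (GPath.ofPath p).cls).comp (GPath.ofArrow g₁).cls := by
  rw [comp_assoc, ofPath_comp_ofArrow, ofArrow_comp_cls]
  simp [GPath.pre]

/-! ### Matrices of a map out of an associated bundle along paths. -/

namespace FlatBundle.Trivialization

theorem classMat_smul {y : 𝒜.Obj} (γ : Pi1 x₀) (c : PathClass x₀ y) :
    τ.classMat (γ • c) = τ.classMat c * (τ.holonomy x₀ γ)⁻¹ :=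
  (τ.classMat_comp _ c).trans (by rw [holonomy_apply, inv_inv])

theorem classMat_comp_ofArrow {y z : 𝒜.Obj} (c : PathClass x₀ y) (g : y ⟶ z) :
    τ.classMat (c.comp (GPath.ofArrow g).cls) = τ.arrowMat g * τ.classMat c := by
  rw [classMat_comp, classMat_ofArrow]

theorem classMat_extend {i : 𝒜.ι} {a : (𝒜.chart i).dom} (c : PathClass x₀ (pt i a))
    (b : (𝒜.chart i).dom) : τ.classMat (extend c b) = τ.classMat c := by
  rw [extend, classMat_comp, classMat_ofPath, one_mul]

/-- For a map from an associated bundle to `D`, the matrix `A` is its expression at the end point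
of `c` in the trivialization of the associated bundle given by `c` and the trivialization `τ`. -/
def IsFrame (H : AssocSpace ρ → D.1.total) {y : 𝒜.Obj} (c : PathClass x₀ y) (A : GL (Fin r) ℂ) :
    Prop :=
  FlatNear (Transition.refl (𝒜.chart y.idx)) (H ∘ assocTriv ρ (i := y.idx) (a := y.pos) c)
    (τ.triv y.idx) A y.pos

variable {τ} {H : AssocSpace ρ → D.1.total} {y z : 𝒜.Obj} {c : PathClass x₀ y}
  {A B : GL (Fin r) ℂ}

theorem IsFrame.unique (hA : τ.IsFrame H c A) (hB : τ.IsFrame H c B) : A = B :=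
  FlatNear.unique (f := Transition.refl _) (x := y.pos) (τ.isBundleChart y.idx) trivial hA hB

/-- An arrow relates the two canonical charts with matrix `ρ 1 = 1`, so only the trivialization of
`D` contributes. -/
theorem IsFrame.comp_ofArrow (h : τ.IsFrame H c A) (g : y ⟶ z) :
    τ.IsFrame H (c.comp (GPath.ofArrow g).cls) (τ.arrowMat g * A) := by
  obtain ⟨i, x⟩ := y
  obtain ⟨j, y⟩ := z
  obtain ⟨f, hx, rfl, rfl⟩ := exists_eq_germTo g
  have h1 : FlatNear f (assocTriv ρ c)
      (assocTriv ρ (c.comp (GPath.ofArrow (germTo f hx rfl)).cls)) (ρ 1) x := by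
    refine flatNear_assocTriv ρ hx rfl ?_
    rw [extend_self, extend_self, one_smul]
  have h2 : FlatNear f (H ∘ assocTriv ρ c)
      (H ∘ assocTriv ρ (c.comp (GPath.ofArrow (germTo f hx rfl)).cls)) 1 x := by
    rw [map_one] at h1
    filter_upwards [h1] with w hw v
    exact congrArg H (hw v)
  have h3 := h2.symm hx
  have hinv : f.symm.toHomeo (f.toHomeo x) = x := f.toHomeo.left_inv hx
  have hfx : f.toHomeo x ∈ f.symm.toHomeo.source := f.toHomeo.map_source hx
  have h4 : FlatNear f (H ∘ assocTriv ρ c) (τ.triv j) (τ.arrowMat (germTo f hx rfl) * A) x :=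
    FlatNear.trans h (τ.flatNear_germ f hx) trivial
  have h5 := h3.trans (by rw [hinv]; exact h4) hfx
  rw [inv_one, mul_one] at h5
  refine h5.congr ?_
  filter_upwards [f.symm.eventually_mem hfx] with w hw
  exact f.toHomeo.right_inv hw

/-- Moving inside the chart domain does not change the sheet, and the matrix is constant on the
connected domain. -/
theorem IsFrame.comp_ofPath {i : 𝒜.ι} {a b : (𝒜.chart i).dom} {c : PathClass x₀ (pt i a)}
    (hH : FlatCompatible (𝒜.chart i) (H ∘ assocTriv ρ c) (𝒜.chart i) (τ.triv i))
    (h : τ.IsFrame H c A) (p : Path a b) : τ.IsFrame H (c.comp (GPath.ofPath p).cls) A := by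
  have := (𝒜.chart i).connected
  have h1 : assocTriv ρ (c.comp (GPath.ofPath p).cls) = assocTriv ρ c := by
    funext q
    rw [← extend_eq]
    exact congrArg (fun s => Quot.mk _ (Quot.mk _ (s q.1), q.2)) (sheet_extend c b)
  have h2 := hH.flatNear_of_isPreconnected (τ.isBundleChart i) (f := Transition.refl _)
    isPreconnected_univ (fun _ _ => trivial) (Set.mem_univ a) (Set.mem_univ b) h
  rw [← h1] at h2
  exact h2

theorem IsFrame.comp_cls (hH : ∀ (i : 𝒜.ι) (a : (𝒜.chart i).dom) (c : PathClass x₀ (pt i a)),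
      FlatCompatible (𝒜.chart i) (H ∘ assocTriv ρ c) (𝒜.chart i) (τ.triv i))
    (h : τ.IsFrame H c A) (d : GPath y z) :
    τ.IsFrame H (c.comp d.cls) (τ.pathMat d * A) := by
  induction d generalizing A with
  | single g₀ p g₁ =>
    rw [PathClass.single_eq, ← PathClass.comp_assoc, ← PathClass.comp_assoc, pathMat, mul_assoc]
    exact ((h.comp_ofArrow g₀).comp_ofPath (hH _ _ _) p).comp_ofArrow g₁
  | cons g₀ p d ih =>
    rw [PathClass.cons_eq, PathClass.single_eq, ← PathClass.comp_assoc, ← PathClass.comp_assoc,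
      ← PathClass.comp_assoc, pathMat, mul_assoc]
    refine ih ?_
    have h1 := ((h.comp_ofArrow g₀).comp_ofPath (hH _ _ _) p).comp_ofArrow (𝟙 _)
    rwa [arrowMat_id, one_mul] at h1

/-- The canonical charts of `c` and `γ • c` differ by `ρ γ` on the fibre. -/
theorem IsFrame.smul (h : τ.IsFrame H c A) (γ : Pi1 x₀) :
    τ.IsFrame H (γ • c) (A * (ρ γ)⁻¹) := by
  filter_upwards [h] with w hw v
  rw [mul_mulVec, hw]
  refine congrArg H ?_
  rw [assocTriv_apply, assocTriv_apply, extend_smul,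
    ← assocMk_comp ρ γ (extend c w) ((ρ γ)⁻¹.1.mulVec v), mulVec_inv_mulVec]

end FlatBundle.Trivialization

/-- An isomorphism of the associated bundle with `D` conjugates `ρ` into the holonomy of `D`. -/
theorem repSetoid_r_holonomy_of_iso {h : IsProperFlat 𝒜 (assoc ρ)}
    (hiso : FlatBundle.Iso ⟨assoc ρ, h⟩ D) : (repSetoid (Pi1 x₀) r).r ρ (τ.holonomy x₀) := by
  obtain ⟨H, -, hflat⟩ := hiso
  have hH : ∀ (i : 𝒜.ι) (a : (𝒜.chart i).dom) (c : PathClass x₀ (pt i a)),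
      FlatCompatible (𝒜.chart i) (H ∘ assocTriv ρ c) (𝒜.chart i) (τ.triv i) := by
    intro i a c
    refine FlatCompatible.trans_of_cover fun x => ?_
    obtain ⟨q, hq, t, ht⟩ := D.2.cover ((𝒜.chart i).proj x)
    exact ⟨q.1, q.2, t, ht, hflat ⟨𝒜.chart i, assocTriv ρ c⟩ ⟨i, a, c, rfl⟩ q hq,
      (τ.flat i q hq).symm⟩
  obtain ⟨A, hA⟩ := (hH x₀.idx x₀.pos (GPath.refl x₀).cls).exists_flatNear
    (τ.isBundleChart x₀.idx) (f := Transition.refl _) (x := x₀.pos) trivial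
  have hA' : τ.IsFrame H (GPath.refl x₀).cls A := hA
  refine ⟨A, fun γ => ?_⟩
  obtain ⟨d, hd⟩ : ∃ d : GPath x₀ x₀, d.cls = γ := Quot.exists_rep γ
  have h1 := hA'.comp_cls hH d
  have h2 := hA'.smul γ
  have h3 : γ • (GPath.refl x₀).cls = (GPath.refl x₀).cls.comp d.cls := by
    rw [PathClass.id_comp, hd]
    exact PathClass.comp_id γ
  rw [h3] at h2
  -- The class `γ` is both the constant loop continued along `d` and the translate of the constant
  -- loop by `γ`; the two resulting matrices agree by uniqueness.
  have h4 : τ.classMat γ * A = A * (ρ γ)⁻¹ := by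
    rw [← h1.unique h2, ← hd]
    rfl
  rw [holonomy_apply, ← mul_right_cancel_iff (a := A), inv_mul_cancel_right,
    inv_mul_eq_iff_eq_mul, ← mul_assoc, h4, inv_mul_cancel_right]

/-- The map from an associated bundle to `D` given by parallel transport. -/
def assocToBundle {A : GL (Fin r) ℂ} (hA : ∀ γ, τ.holonomy x₀ γ = A * ρ γ * A⁻¹) :
    AssocSpace ρ → D.1.total :=
  Quot.lift (fun p => Quot.lift (fun c : PathSpace x₀ => τ.triv c.target.idx
      (c.target.pos, (τ.classMat c.pathClass * A).1.mulVec p.2)) (by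
    rintro ⟨y, c⟩ ⟨z, d⟩ ⟨g, hg⟩
    change y ⟶ z at g
    obtain rfl : d = c.comp (GPath.ofArrow g).cls := hg
    change τ.triv y.idx (y.pos, (τ.classMat c * A).1.mulVec p.2) =
      τ.triv z.idx (z.pos, (τ.classMat (c.comp (GPath.ofArrow g).cls) * A).1.mulVec p.2)
    rw [classMat_comp_ofArrow, mul_assoc,
      mul_mulVec (τ.arrowMat g), triv_arrowMat]) p.1) (by
    rintro ⟨x, v⟩ _ ⟨γ, rfl⟩
    induction x using Quot.inductionOn with
    | h c =>
      obtain ⟨y, c⟩ := c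
      change τ.triv y.idx (y.pos, (τ.classMat c * A).1.mulVec v) =
        τ.triv y.idx (y.pos, (τ.classMat (γ • c) * A).1.mulVec ((ρ γ).1.mulVec v))
      rw [← mul_mulVec, classMat_smul, hA]
      congr 4
      group)

/-! ### Parallel transport as an isomorphism from the associated bundle. -/

section AssocToBundle

variable {A : GL (Fin r) ℂ} (hA : ∀ γ, τ.holonomy x₀ γ = A * ρ γ * A⁻¹)

theorem assocToBundle_assocMk {y : 𝒜.Obj} (c : PathClass x₀ y) (v : Fin r → ℂ) :
    assocToBundle τ hA (assocMk ρ c v) =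
      τ.triv y.idx (y.pos, (τ.classMat c * A).1.mulVec v) := rfl

theorem assocToBundle_assocTriv {i : 𝒜.ι} {a : (𝒜.chart i).dom} (c : PathClass x₀ (pt i a))
    (p : (𝒜.chart i).dom × (Fin r → ℂ)) : assocToBundle τ hA (assocTriv ρ c p) =
      τ.triv i (p.1, (τ.classMat c * A).1.mulVec p.2) := by
  rw [show assocTriv ρ c p = assocMk ρ (extend c p.1) p.2 from rfl, assocToBundle_assocMk,
    classMat_extend]

theorem proj_assocToBundle (e : AssocSpace ρ) :
    D.1.proj (assocToBundle τ hA e) = (assoc ρ).proj e := by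
  obtain ⟨y, c, v, rfl⟩ := exists_eq_assocMk ρ e
  rw [assocToBundle_assocMk, (τ.isBundleChart y.idx).proj_eq, assoc_proj_assocMk]

/-- Two points with the same image lie over the same point of `Z`, so an arrow brings them into one
fibre. There only isotropy identifies vectors, and isotropy is again given by arrows. -/
theorem assocToBundle_injective : Function.Injective (assocToBundle τ hA) := by
  intro e e' hee
  have hproj := congrArg D.1.proj hee
  rw [proj_assocToBundle, proj_assocToBundle] at hproj
  obtain ⟨y, c, v, rfl⟩ := exists_eq_assocMk ρ e
  obtain ⟨z, d, w, rfl⟩ := exists_eq_assocMk ρ e'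
  rw [assoc_proj_assocMk, assoc_proj_assocMk] at hproj
  obtain ⟨g⟩ := exists_hom hproj
  rw [← assocMk_ofArrow ρ c g, assocToBundle_assocMk, assocToBundle_assocMk] at hee
  obtain ⟨R, hR⟩ := (τ.isBundleChart z.idx).exists_rep
  obtain ⟨k, hk⟩ := (hR _ _).1 hee
  simp only [Prod.mk.injEq] at hk
  obtain ⟨hkz, hk⟩ := hk
  -- The isotropy element `k` is absorbed into the arrow. For the loop `γ` relating `c` and `d`
  -- through `g ≫ κ`, cancelling invertible matrices leaves `w = ρ(γ) v`.
  let κ : z ⟶ z := germTo (i := z.idx) (j := z.idx) (Transition.ofSMul _ k)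
    (Transition.mem_ofSMul_source k z.pos) hkz
  have hκ : R k = τ.arrowMat κ :=
    (τ.flatNear_iff (x := z) (y := z) ⟨Transition.ofSMul _ k, trivial, hkz⟩ (R k)).1
      (flatNear_ofSMul hR k z.pos)
  obtain ⟨γ, rfl⟩ := exists_loop c d (g ≫ κ)
  refine (assocMk_eq_iff ρ _ _ _ _).2 ⟨γ, g ≫ κ, rfl, ?_⟩
  rw [classMat_comp_ofArrow, classMat_comp_ofArrow, classMat_smul, hκ, arrowMat_comp, hA,
    ← mul_mulVec] at hk
  have hk' := congrArg (fun u => ((τ.arrowMat κ * τ.arrowMat g * τ.classMat c * A)⁻¹).1.mulVec u) hk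
  simp only [← mul_mulVec] at hk'
  rw [show (τ.arrowMat κ * τ.arrowMat g * τ.classMat c * A)⁻¹ *
      (τ.arrowMat κ * (τ.arrowMat g * τ.classMat c * A)) = 1 by group,
    show (τ.arrowMat κ * τ.arrowMat g * τ.classMat c * A)⁻¹ *
      (τ.arrowMat κ * τ.arrowMat g * (τ.classMat c * (A * ρ γ * A⁻¹)⁻¹) * A) = (ρ γ)⁻¹ by group,
    one_mulVec] at hk'
  rw [hk', mulVec_inv_mulVec]

variable [ConnectedSpace Z]

theorem assocToBundle_surjective : Function.Surjective (assocToBundle τ hA) := by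
  intro e
  obtain ⟨i, x, hx⟩ := 𝒜.cover (D.1.proj e)
  obtain ⟨⟨w, v⟩, rfl⟩ := (τ.isBundleChart i).range_eq e ⟨x, hx⟩
  obtain ⟨c⟩ := nonempty_pathClass x₀ (pt i w)
  exact ⟨assocMk ρ c (((τ.classMat c * A)⁻¹).1.mulVec v), by
    rw [assocToBundle_assocMk, mulVec_inv_mulVec]⟩

/-- On each sheet the map is a constant invertible matrix followed by the trivialization `τ`, and
the sheets form an open quotient map. -/
theorem isOpenMap_and_continuous_assocToBundle :
    IsOpenMap (assocToBundle τ hA) ∧ Continuous (assocToBundle τ hA) := by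
  choose a c _ using exists_assoc_chart ρ
  have hq := isOpenQuotientMap_assocTriv ρ c
  have hcomp : assocToBundle τ hA ∘ (fun p : Σ i : 𝒜.ι, (𝒜.chart i).dom × (Fin r → ℂ) =>
      assocTriv ρ (c p.1) p.2) = fun p => τ.triv p.1
        (Prod.map id (mulVecHomeomorph (τ.classMat (c p.1) * A)) p.2) :=
    funext fun p => assocToBundle_assocTriv τ hA (c p.1) p.2
  constructor
  · refine IsOpenMap.of_comp hq.continuous hq.surjective ?_
    rw [hcomp]
    exact isOpenMap_sigma.2 fun i => (τ.isBundleChart i).isOpenMap.comp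
      (IsOpenMap.id.prodMap (mulVecHomeomorph (τ.classMat (c i) * A)).isOpenMap)
  · rw [hq.isQuotientMap.continuous_iff, hcomp]
    exact continuous_sigma fun i => (τ.isBundleChart i).continuous.comp
      (continuous_id.prodMap (mulVecHomeomorph (τ.classMat (c i) * A)).continuous)

end AssocToBundle

theorem iso_of_holonomy_eq [ConnectedSpace Z] {A : GL (Fin r) ℂ}
    (hA : ∀ γ, τ.holonomy x₀ γ = A * ρ γ * A⁻¹) (h : IsProperFlat 𝒜 (assoc ρ)) :
    FlatBundle.Iso ⟨assoc ρ, h⟩ D := by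
  obtain ⟨hopen, hcont⟩ := isOpenMap_and_continuous_assocToBundle τ hA
  refine ⟨(Equiv.ofBijective _ ⟨assocToBundle_injective τ hA,
    assocToBundle_surjective τ hA⟩).toHomeomorphOfContinuousOpen hcont hopen,
    proj_assocToBundle τ hA, ?_⟩
  rintro _ ⟨i, a, c, rfl⟩ q hq x y hxy
  obtain ⟨f, B, hx, hy, hf⟩ := τ.flat i q hq x y hxy
  refine ⟨f, B * (τ.classMat c * A), hx, hy, fun w hw v => ?_⟩
  rw [mul_mulVec, hf w hw]
  exact (assocToBundle_assocTriv τ hA c (w, v)).symm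

/-- The associated bundle is isomorphic to `D` if and only if `ρ` is conjugate to the holonomy
representation of `D`. -/
theorem assoc_iso_iff [ConnectedSpace Z] (h : IsProperFlat 𝒜 (assoc ρ)) :
    FlatBundle.Iso ⟨assoc ρ, h⟩ D ↔ (repSetoid (Pi1 x₀) r).r ρ (τ.holonomy x₀) :=
  ⟨repSetoid_r_holonomy_of_iso τ, fun ⟨_, hA⟩ => iso_of_holonomy_eq τ hA h⟩

end Correspondence

end FlatOrb

end

/-! ### The classification theorem. -/

open FlatOrb FlatOrb.OrbAtlas in
theorem theorem0p1 {m : ℕ} {Z : Type u} [TopologicalSpace Z] [T2Space Z]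
    [SecondCountableTopology Z] [ConnectedSpace Z] (𝒜 : OrbAtlas m Z) (x₀ : 𝒜.Obj) (r : ℕ) :
    -- every proper flat bundle has a flat trivialization over the charts of the atlas
    (∀ D : FlatBundle 𝒜 r, Nonempty D.Trivialization) ∧
    -- parallel transport along a path of the groupoid is well defined
    (∀ (D : FlatBundle 𝒜 r) (τ : D.Trivialization) (x y : 𝒜.Obj) (c : GPath x y),
      ∃! A : Matrix.GeneralLinearGroup (Fin r) ℂ, τ.Transport c A) ∧
    -- `X ×_ρ ℂ^r` is a proper flat bundle
    ∃ h : ∀ ρ : Pi1 x₀ →* Matrix.GeneralLinearGroup (Fin r) ℂ, IsProperFlat 𝒜 (assoc ρ),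
      -- `ρ ↦ X ×_ρ ℂ^r` induces a bijection
      ∃ Φ : RepClass (Pi1 x₀) r ≃ BundleClass 𝒜 r,
        (∀ ρ : Pi1 x₀ →* Matrix.GeneralLinearGroup (Fin r) ℂ,
          Φ (repCls ρ) = FlatBundle.cls ⟨assoc ρ, h ρ⟩) ∧
        -- the inverse is the holonomy representation, for every choice of trivialization
        ∀ (D : FlatBundle 𝒜 r) (τ : D.Trivialization),
          ∃ ρ : Pi1 x₀ →* Matrix.GeneralLinearGroup (Fin r) ℂ,
            τ.IsHolonomy ρ ∧ Φ.symm (FlatBundle.cls D) = repCls ρ := by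
  refine ⟨fun D => D.nonempty_trivialization, fun D τ x y c => ?_, isProperFlat_assoc, ?_⟩
  · exact ⟨τ.pathMat c, (τ.transport_iff c _).2 rfl, fun A hA => (τ.transport_iff c A).1 hA⟩
  -- Both `ρ` and `ρ'` are compared with the holonomy of the bundle of `ρ'`; that `ρ'` is conjugate
  -- to it follows from the identity isomorphism.
  have hiff : ∀ ρ ρ' : Pi1 x₀ →* Matrix.GeneralLinearGroup (Fin r) ℂ,
      FlatBundle.Iso ⟨assoc ρ, isProperFlat_assoc ρ⟩ ⟨assoc ρ', isProperFlat_assoc ρ'⟩ ↔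
        (repSetoid (Pi1 x₀) r).r ρ ρ' := by
    intro ρ ρ'
    obtain ⟨τ⟩ := FlatBundle.nonempty_trivialization ⟨assoc ρ', isProperFlat_assoc ρ'⟩
    have h' := (assoc_iso_iff τ (isProperFlat_assoc ρ')).1 (FlatBundle.iso_equivalence.refl _)
    rw [assoc_iso_iff τ]
    exact ⟨fun h => (repSetoid _ r).iseqv.trans h ((repSetoid _ r).iseqv.symm h'),
      fun h => (repSetoid _ r).iseqv.trans h h'⟩
  let F : RepClass (Pi1 x₀) r → BundleClass 𝒜 r :=
    Quotient.lift (fun ρ => FlatBundle.cls ⟨assoc ρ, isProperFlat_assoc ρ⟩)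
      fun ρ ρ' h => Quotient.sound ((hiff ρ ρ').2 h)
  -- The conjugating matrix is the identity here. This gives surjectivity and, for every `τ`, the
  -- description of the inverse.
  have hF : ∀ (D : FlatBundle 𝒜 r) (τ : D.Trivialization),
      F (repCls (τ.holonomy x₀)) = FlatBundle.cls D := fun D τ =>
    Quotient.sound ((assoc_iso_iff τ _).2 ((repSetoid _ r).iseqv.refl _))
  have hbij : Function.Bijective F := by
    constructor
    · intro a b hab
      induction a using Quotient.inductionOn with
      | h ρ =>
        induction b using Quotient.inductionOn with
        | h ρ' => exact Quotient.sound ((hiff ρ ρ').1 (Quotient.exact hab))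
    · intro b
      induction b using Quotient.inductionOn with
      | h D =>
        obtain ⟨τ⟩ := D.nonempty_trivialization
        exact ⟨_, hF D τ⟩
  exact ⟨Equiv.ofBijective F hbij, fun ρ => rfl, fun D τ => ⟨τ.holonomy x₀,
    τ.isHolonomy_holonomy x₀, (Equiv.symm_apply_eq _).2 (hF D τ).symm⟩⟩
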